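/- Corollary 3.1. For $n\in\mathbb N=\{0,1,2,\dots\}$ and $b,c\in\mathbb Z$, let $T_n(b,c)$ be the coefficient of $x^n$ in $(x^2+bx+c)^n$, and let $$M_n(b,c)=\sum_{k=0}^{\lfloor n/2\rfloor}\binom{n}{2k}C_k\,b^{n-2k}c^k,$$ where $C_k=\binom{2k}{k}/(k+1)$ is the $k$-th Catalan number. Write $T_n=T_n(1,1)$ (central trinomial coefficients) and $M_n=M_n(1,1)$ (Motzkin numbers). For integers $1\le k\le n$ put $$w(n,k)=\frac1k\binom{n-1}{k-1}\binom{n+k}{k-1}.$$ For a prime $p>3$ let $q_p(3)=(3^{p-1}-1)/p$ and let $\left(\frac{\cdot}{\cdot}\right)$ denote the Legendre symbol. For rational numbers $x,y$, the congruence $x\equiv y\pmod{p^m}$ means that $(x-y)/p^m$ is a rational number whose denominator in lowest terms is not divisible by $p$. (i) For every integer $n\ge1$, $$\frac1n\sum_{k=0}^{n-1}T_kM_k(-3)^{n-1-k}=\sum_{k=1}^n w(n,k)C_{k-1}(-3)^{n-k}\in\mathbb Z$$ and $$\frac1n\sum_{k=0}^{n-1}\frac{T_k(3,3)M_k(3,3)}{(-3)^k}=\sum_{k=1}^n(-1)^{k-1}w(n,k)C_{k-1}\in\mathbb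 Z.$$ (ii) For every prime $p>3$, $$\sum_{k=0}^{p-1}\frac{T_kM_k}{(-3)^k}\equiv\frac p2\left(\left(\frac p3\right)-1\right)+\frac{p^2}2\left(q_p(3)+\left(\frac p3\right)+3\right)\pmod{p^3},$$ $$\sum_{k=0}^{p-1}\frac{T_k(3,3)M_k(3,3)}{(-3)^k}\equiv\frac{3p}2\left(\left(\frac p3\right)-1\right)+\frac{p^2}2\left(3\left(\frac p3\right)+1\right)\pmod{p^3},$$ $$\sum_{k=0}^{p-1}\frac{kT_kM_k}{(-3)^k}\equiv2\left(\frac p3\right)\pmod p\quad\text{and}\quad\sum_{k=0}^{p-1}\frac{kT_k(3,3)M_k(3,3)}{(-3)^k}\equiv2\left(\frac{-1}p\right)\pmod p.$$ -/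

import Mathlib

namespace SunTM

/-- The generalized central trinomial coefficient `T_n(b,c) = [x^n] (x^2 + b x + c)^n`. -/
noncomputable def T (n : ℕ) (b c : ℤ) : ℤ :=
  ((Polynomial.X ^ 2 + Polynomial.C b * Polynomial.X + Polynomial.C c : Polynomial ℤ) ^ n).coeff n

/-- The generalized Motzkin number
`M_n(b,c) = ∑_{k=0}^{⌊n/2⌋} binom(n,2k) C_k b^(n-2k) c^k`, with `C_k` the Catalan number.
`M_n(1,1)` is the usual Motzkin number. -/
def M (n : ℕ) (b c : ℤ) : ℤ :=
  ∑ k ∈ Finset.range (n / 2 + 1), (n.choose (2 * k) : ℤ) * (catalan k : ℤ) * b ^ (n - 2 * k) * c ^ k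

/-- `w(n,k) = (1/k) binom(n-1,k-1) binom(n+k,k-1)` for `1 ≤ k ≤ n`, as a rational number. -/
def w (n k : ℕ) : ℚ :=
  (1 / (k : ℚ)) * ((n - 1).choose (k - 1) : ℚ) * ((n + k).choose (k - 1) : ℚ)

/-- The Fermat quotient `q_p(a) = (a^(p-1) - 1) / p`, as a rational number. -/
def fermatQuotient (p : ℕ) (a : ℤ) : ℚ := ((a : ℚ) ^ (p - 1) - 1) / (p : ℚ)

/-- Congruence `x ≡ y (mod p^m)` of rational numbers: `x - y` is `p^m` times a rational number
whose denominator (in lowest terms) is not divisible by `p`. -/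
def CongMod (p m : ℕ) (x y : ℚ) : Prop :=
  ∃ z : ℚ, ¬ p ∣ z.den ∧ x - y = (p : ℚ) ^ m * z

end SunTM

namespace SunTM

open Finset

/-! ### Explicit formula and recurrences for `T` and `M` -/

/-! Write `d = b ^ 2 - 4 * c` and `t = c / d`; both pairs `(1, 1)` and `(3, 3)` have `d = -3`, with
`t = -1/3` and `t = -1`. Everything rests on a closed form for the partial sums of `T_k M_k / d ^
k`. Multiplying `two_mul_M` by `T_n` expresses `T_n M_n` through `T_n ^ 2` and `b T_n T_{n+1}`, and
the three-term recurrence of `T` determines both as polynomials in `t` (`T_sq_expansion`). The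
resulting coefficients of `T_n M_n / d ^ n` are differences in `n` of `partialCoeff`, so the sum
over `k < n` telescopes (`sum_T_mul_M`). As `partialCoeff n j = n * wInt n j * catalan j` for
positive `n`, the identities and integrality in (i) follow.

For `n = p` the closed form has a factor `p`, so modulo `p ^ 3` it suffices to know `∑ wInt p j *
catalan j * t ^ j` modulo `p ^ 2`. There `wInt_mul_catalan` splits each summand with `j < p - 1`
into a multiple of `catalan j` and a binomial term. With `t = -1/m`, the binomial terms sum to
`T_p(2 - m, 1)` up to boundary terms, and `T_p(1, 1) ≡ 1`. The Catalan sum is a binomial transform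
of a second-order recurrence (`sum_catalan_eq`), which collapses at `n = p`. For `m = 1` and `m = 3`
that recurrence is periodic with period dividing 6, whence the symbol `(p/3)`; the Fermat quotient
comes from powers of 3.

The sums weighted by `k` arise by adding the closed form over all `n < p`. Modulo `p`, each
`partialCoeff n j` is a polynomial in `n`, and summing over the prime field picks out the
coefficient of degree `p - 1`; only `j = (p - 1) / 2` survives (`sum_partialCoeff`). -/

theorem coeff_X_sq_add_C_pow (c : ℤ) (m : ℕ) :
    ((Polynomial.X ^ 2 + Polynomial.C c : Polynomial ℤ) ^ m).coeff m
      = ∑ i ∈ range (m + 1), if 2 * i = m then (m.choose i : ℤ) * c ^ (m - i) else 0 := by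
  rw [add_pow, Polynomial.finsetSum_coeff]
  refine sum_congr rfl fun i _ => ?_
  rw [← pow_mul, ← Polynomial.C_pow, mul_assoc, ← Polynomial.C_eq_natCast, ← Polynomial.C_mul,
    Polynomial.coeff_mul_C, Polynomial.coeff_X_pow]
  by_cases h : 2 * i = m
  · simp [h, mul_comm]
  · simp [h, Ne.symm h]

theorem T_eq_sum_double (n : ℕ) (b c : ℤ) :
    T n b c = ∑ m ∈ range (n + 1), (n.choose m : ℤ) * b ^ (n - m) *
      ∑ i ∈ range (m + 1), if 2 * i = m then (m.choose i : ℤ) * c ^ (m - i) else 0 := by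
  have h : (Polynomial.X ^ 2 + Polynomial.C b * Polynomial.X + Polynomial.C c : Polynomial ℤ)
      = (Polynomial.X ^ 2 + Polynomial.C c) + Polynomial.C b * Polynomial.X := by ring
  rw [T, h, add_pow, Polynomial.finsetSum_coeff]
  refine sum_congr rfl fun m hm => ?_
  have hm' : m ≤ n := by simpa [Nat.lt_succ_iff] using hm
  have h2 : (Polynomial.X ^ 2 + Polynomial.C c : Polynomial ℤ) ^ m
      * (Polynomial.C b * Polynomial.X) ^ (n - m) * (n.choose m : Polynomial ℤ)
      = ((Polynomial.X ^ 2 + Polynomial.C c : Polynomial ℤ) ^ m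
        * Polynomial.C ((n.choose m : ℤ) * b ^ (n - m))) * Polynomial.X ^ (n - m) := by
    simp only [mul_pow, Polynomial.C_mul, Polynomial.C_pow, map_natCast]
    ring
  rw [h2]
  conv_lhs => rw [show n = m + (n - m) by omega]
  simp only [Nat.add_sub_cancel_left]
  rw [Polynomial.coeff_mul_X_pow, Polynomial.coeff_mul_C, coeff_X_sq_add_C_pow, mul_comm]
  simp [Nat.add_sub_cancel' hm']

theorem T_eq_sum {n N : ℕ} (b c : ℤ) (hN : n / 2 < N) :
    T n b c = ∑ k ∈ range N,
      (n.choose (2 * k) : ℤ) * (Nat.centralBinom k : ℤ) * b ^ (n - 2 * k) * c ^ k := by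
  have hinner : ∀ m ∈ range (n + 1), (n.choose m : ℤ) * b ^ (n - m) *
      (∑ i ∈ range (m + 1), if 2 * i = m then (m.choose i : ℤ) * c ^ (m - i) else 0)
      = ∑ i ∈ range N, if 2 * i = m then
        (n.choose m : ℤ) * b ^ (n - m) * ((m.choose i : ℤ) * c ^ (m - i)) else 0 := by
    intro m hm
    have hm' : m ≤ n := by simpa [Nat.lt_succ_iff] using hm
    rw [mul_sum]
    simp only [mul_ite, mul_zero]
    rw [← sum_filter, ← sum_filter]
    refine sum_congr ?_ fun _ _ => rfl
    ext i
    simp only [mem_filter, mem_range]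
    omega
  rw [T_eq_sum_double, sum_congr rfl hinner, sum_comm]
  refine sum_congr rfl fun i _ => ?_
  rw [sum_ite_eq]
  split_ifs with h
  · rw [Nat.centralBinom, show 2 * i - i = i by omega]
    ring
  · have : n < 2 * i := by simpa using h
    simp [Nat.choose_eq_zero_of_lt this]

theorem M_eq_sum {n N : ℕ} (b c : ℤ) (hN : n / 2 < N) :
    M n b c = ∑ k ∈ range N,
      (n.choose (2 * k) : ℤ) * (catalan k : ℤ) * b ^ (n - 2 * k) * c ^ k := by
  rw [M]
  refine sum_subset (fun i hi => ?_) fun k _ hk => ?_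
  · simp only [mem_range] at *; omega
  · have : n < 2 * k := by simp only [mem_range] at hk; omega
    simp [Nat.choose_eq_zero_of_lt this]

theorem choose_mul_pow_sub {R : Type*} [CommSemiring R] (n i j : ℕ) (b : R) :
    (n.choose (i + j) : R) * (b ^ j * b ^ (n - (i + j))) = (n.choose (i + j) : R) * b ^ (n - i) := by
  by_cases h : i + j ≤ n
  · rw [← pow_add, show j + (n - (i + j)) = n - i by omega]
  · simp [Nat.choose_eq_zero_of_lt (not_le.mp h)]

theorem centralBinom_succ_eq (k : ℕ) :
    (Nat.centralBinom (k + 1) : ℤ) = 2 * (2 * k + 1) * (catalan k : ℤ) := by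
  have h1 := Nat.succ_mul_centralBinom_succ k
  have h2 := succ_mul_catalan_eq_centralBinom k
  rw [← h2] at h1
  have h3 : (k + 1) * Nat.centralBinom (k + 1) = (k + 1) * (2 * (2 * k + 1) * catalan k) := by
    rw [h1]; ring
  exact_mod_cast Nat.eq_of_mul_eq_mul_left (Nat.succ_pos k) h3

theorem choose_succ_mul {R : Type*} [CommRing R] (N i : ℕ) :
    (N.choose (i + 1) : R) * ((i : R) + 1) = (N.choose i : R) * ((N : R) - i) := by
  by_cases h : i ≤ N
  · have := Nat.choose_succ_right_eq N i
    rw [← Nat.cast_sub h]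
    exact_mod_cast congrArg (Nat.cast : ℕ → R) this
  · simp [Nat.choose_eq_zero_of_lt (not_le.mp h),
      Nat.choose_eq_zero_of_lt (lt_of_lt_of_le (not_le.mp h) (Nat.le_succ i))]

/-- Pascal's rule leaves `binom(n+1, 2k+1) * centralBinom (k+1)` in the coefficient, which equals `2
(n+1) * binom(n, 2k) * catalan k`. -/
theorem T_add_two (n : ℕ) (b c : ℤ) :
    T (n + 2) b c = b * T (n + 1) b c + 2 * c * (n + 1) * M n b c := by
  rw [T_eq_sum (N := n + 2 + 1) b c (by omega), T_eq_sum (N := n + 2 + 1) b c (by omega),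
    M_eq_sum (N := n + 2) b c (by omega), sum_range_succ' _ (n + 2), sum_range_succ' _ (n + 2),
    mul_add, mul_sum, mul_sum]
  have key : ∀ k ∈ range (n + 2),
      ((n + 2).choose (2 * (k + 1)) : ℤ) * (Nat.centralBinom (k + 1) : ℤ)
          * b ^ (n + 2 - 2 * (k + 1)) * c ^ (k + 1)
        = b * (((n + 1).choose (2 * (k + 1)) : ℤ) * (Nat.centralBinom (k + 1) : ℤ)
          * b ^ (n + 1 - 2 * (k + 1)) * c ^ (k + 1))
        + 2 * c * (n + 1) * ((n.choose (2 * k) : ℤ) * (catalan k : ℤ) * b ^ (n - 2 * k) * c ^ k) := by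
    intro k _
    have h1 := choose_mul_pow_sub (n + 1) (2 * k + 1) 1 b
    have h2 : ((n + 2).choose (2 * k + 2) : ℤ)
        = (n + 1).choose (2 * k + 1) + (n + 1).choose (2 * k + 2) := by
      exact_mod_cast Nat.choose_succ_succ (n + 1) (2 * k + 1)
    have h3 : ((n : ℤ) + 1) * n.choose (2 * k) = (n + 1).choose (2 * k + 1) * (2 * k + 1) := by
      exact_mod_cast Nat.add_one_mul_choose_eq n (2 * k)
    rw [show 2 * (k + 1) = 2 * k + 2 by ring, h2, centralBinom_succ_eq,
      show n + 2 - (2 * k + 2) = n - 2 * k by omega]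
    rw [show n + 1 - (2 * k + 1) = n - 2 * k by omega, pow_one,
      show 2 * k + 1 + 1 = 2 * k + 2 by ring] at h1
    linear_combination (-2 * (2 * (k : ℤ) + 1) * catalan k * c ^ (k + 1)) * h1
      - 2 * catalan k * b ^ (n - 2 * k) * c ^ (k + 1) * h3
  rw [sum_congr rfl key, sum_add_distrib]
  simp [pow_succ]
  ring

theorem two_mul_M (n : ℕ) (b c : ℤ) :
    2 * (n + 2) * c * M n b c = b * T (n + 1) b c - (b ^ 2 - 4 * c) * T n b c := by
  have key : ∀ k ∈ range (n + 1),
      2 * ((n : ℤ) + 2) * c * ((n.choose (2 * k) : ℤ) * (catalan k : ℤ) * b ^ (n - 2 * k) * c ^ k)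
        = b * (((n + 1).choose (2 * (k + 1)) : ℤ) * (Nat.centralBinom (k + 1) : ℤ)
          * b ^ (n + 1 - 2 * (k + 1)) * c ^ (k + 1))
        - b ^ 2 * ((n.choose (2 * (k + 1)) : ℤ) * (Nat.centralBinom (k + 1) : ℤ)
          * b ^ (n - 2 * (k + 1)) * c ^ (k + 1))
        + 4 * c * ((n.choose (2 * k) : ℤ) * (Nat.centralBinom k : ℤ) * b ^ (n - 2 * k) * c ^ k) := by
    intro k _
    have h1 := choose_mul_pow_sub (n + 1) (2 * k + 1) 1 b
    have h1' := choose_mul_pow_sub n (2 * k) 2 b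
    have h2 : ((n + 1).choose (2 * k + 2) : ℤ)
        = n.choose (2 * k + 1) + n.choose (2 * k + 2) := by
      exact_mod_cast Nat.choose_succ_succ n (2 * k + 1)
    have h3 := choose_succ_mul (R := ℤ) n (2 * k)
    have h4 : ((k : ℤ) + 1) * catalan k = Nat.centralBinom k := by
      exact_mod_cast succ_mul_catalan_eq_centralBinom k
    rw [show n + 1 - (2 * k + 1) = n - 2 * k by omega, pow_one,
      show 2 * k + 1 + 1 = 2 * k + 2 by ring] at h1
    rw [show 2 * (k + 1) = 2 * k + 2 by ring, centralBinom_succ_eq, ← h4]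
    rw [h2] at h1 ⊢
    push_cast at h3
    linear_combination (-2 * (2 * (k : ℤ) + 1) * catalan k * c ^ (k + 1)) * h1
      + (2 * (2 * (k : ℤ) + 1) * catalan k * c ^ (k + 1)) * h1'
      - 2 * catalan k * b ^ (n - 2 * k) * c ^ (k + 1) * h3
  have hM := M_eq_sum (n := n) (N := n + 1) b c (by omega)
  have hT := T_eq_sum (n := n) (N := n + 1) b c (by omega)
  have hT' := T_eq_sum (n := n) (N := n + 1 + 1) b c (by omega)
  have hT1 := T_eq_sum (n := n + 1) (N := n + 1 + 1) b c (by omega)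
  rw [sum_range_succ'] at hT' hT1
  have hsum := sum_congr rfl key
  rw [sum_add_distrib, sum_sub_distrib, ← mul_sum, ← mul_sum, ← mul_sum, ← mul_sum] at hsum
  simp only [mul_zero, Nat.choose_zero_right, Nat.cast_one, Nat.centralBinom_zero, Nat.sub_zero,
    pow_zero, mul_one, one_mul] at hT' hT1
  linear_combination hsum + 2 * ((n : ℤ) + 2) * c * hM - b * hT1 + b ^ 2 * hT' - 4 * c * hT

theorem T_zero (b c : ℤ) : T 0 b c = 1 := by simp [T]

theorem T_one (b c : ℤ) : T 1 b c = b := by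
  rw [T_eq_sum (N := 1) b c (by omega)]; simp

theorem T_three_term (n : ℕ) (b c : ℤ) :
    (n + 2) * T (n + 2) b c
      = (2 * n + 3) * b * T (n + 1) b c - (n + 1) * (b ^ 2 - 4 * c) * T n b c := by
  linear_combination ((n : ℤ) + 2) * T_add_two n b c + ((n : ℤ) + 1) * two_mul_M n b c

/-! ### Product formulas for `T_n ^ 2` and `T_n * M_n` -/

/-- The coefficient of `(c / d) ^ j` in `T_n(b,c) ^ 2 / d ^ n`, where `d = b ^ 2 - 4 c`. -/
def sqCoeff (n j : ℕ) : ℚ := ((n + j).choose (2 * j) : ℚ) * (Nat.centralBinom j : ℚ) ^ 2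

/-- The coefficient of `(c / d) ^ j` in `T_n(b,c) * M_n(b,c) / d ^ n`, where `d = b ^ 2 - 4 c`. -/
def prodCoeff (n j : ℕ) : ℚ :=
  (Nat.centralBinom j : ℚ) ^ 2 * ((n + 1 + j).choose (2 * j) : ℚ) * (n + 1 - j)
    * ((2 * n + 3) * (j + 1) - (n + 1)) / ((j + 1) ^ 2 * (n + 1) * (n + 2))

/-- The coefficient of `(c / d) ^ j` in `∑ k < n, T_k(b,c) * M_k(b,c) / d ^ k`,
where `d = b ^ 2 - 4 c`. -/
def partialCoeff (n j : ℕ) : ℕ := n.choose (j + 1) * (n + j + 1).choose j * catalan j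

theorem choose_shift_left (n j : ℕ) :
    ((n + j + 2).choose (2 * j) : ℚ) * ((n : ℚ) + 2 - j)
      = ((n + 1 + j).choose (2 * j) : ℚ) * (n + 2 + j) := by
  by_cases h : 2 * j ≤ n + 1 + j
  · have := Nat.choose_mul_succ_eq (n + 1 + j) (2 * j)
    have h2 : ((n + 1 + j + 1 - 2 * j : ℕ) : ℚ) = (n : ℚ) + 2 - j := by
      rw [Nat.cast_sub (by omega)]; push_cast; ring
    rw [← h2, show n + j + 2 = n + 1 + j + 1 by ring]
    have h3 : ((n + 1 + j + 1 : ℕ) : ℚ) = n + 2 + j := by push_cast; ring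
    rw [← h3]
    exact_mod_cast this.symm
  · have h1 : n + 2 ≤ j := by omega
    rcases h1.eq_or_lt with rfl | h1
    · simp [Nat.choose_eq_zero_of_lt (show n + 1 + (n + 2) < 2 * (n + 2) by omega)]
    · simp [Nat.choose_eq_zero_of_lt (show n + 1 + j < 2 * j by omega),
        Nat.choose_eq_zero_of_lt (show n + j + 2 < 2 * j by omega)]

theorem choose_shift_right (n j : ℕ) :
    ((n + 1 + j).choose (2 * j + 2) : ℚ) * ((2 * j + 1) * (2 * j + 2))
      = ((n + 1 + j).choose (2 * j) : ℚ) * ((n + 1 - j) * (n - j)) := by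
  have h1 := choose_succ_mul (R := ℚ) (n + 1 + j) (2 * j + 1)
  have h2 := choose_succ_mul (R := ℚ) (n + 1 + j) (2 * j)
  push_cast at h1 h2
  linear_combination (2 * (j : ℚ) + 1) * h1 + ((n : ℚ) - j) * h2

theorem centralBinom_succ_rat (j : ℕ) :
    (Nat.centralBinom (j + 1) : ℚ) = 2 * (2 * j + 1) * Nat.centralBinom j / (j + 1) := by
  rw [eq_div_iff (by positivity)]
  have := Nat.succ_mul_centralBinom_succ j
  have h : ((j : ℚ) + 1) * Nat.centralBinom (j + 1) = 2 * (2 * j + 1) * Nat.centralBinom j := by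
    exact_mod_cast this
  linear_combination h

/-- This and the next lemmas bring all coefficients in the recurrences to the common factor
`centralBinom j ^ 2 * binom(n+1+j, 2j)`, so that only identities between rational functions remain.
-/
theorem sqCoeff_succ_right (n j : ℕ) :
    sqCoeff n (j + 1) = (Nat.centralBinom j : ℚ) ^ 2 * ((n + 1 + j).choose (2 * j) : ℚ)
      * ((n + 1 - j) * (n - j)) * (2 * (2 * j + 1)) / ((j + 1) ^ 3) := by
  have h := choose_shift_right n j
  rw [sqCoeff, centralBinom_succ_rat, show n + (j + 1) = n + 1 + j by ring,
    show 2 * (j + 1) = 2 * j + 2 by ring]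
  rw [← eq_div_iff (by positivity)] at h
  rw [h]
  field_simp

theorem sqCoeff_succ_succ (n j : ℕ) :
    sqCoeff (n + 1) (j + 1) = (Nat.centralBinom j : ℚ) ^ 2 * ((n + 1 + j).choose (2 * j) : ℚ)
      * ((n + 2 + j) * (n + 1 - j)) * (2 * (2 * j + 1)) / ((j + 1) ^ 3) := by
  have h := choose_shift_left n j
  rw [sqCoeff_succ_right, show n + 1 + 1 + j = n + j + 2 by ring]
  congr 1
  push_cast
  linear_combination (Nat.centralBinom j : ℚ) ^ 2 * (n + 1 - j) * (2 * (2 * j + 1)) * h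

theorem sqCoeff_add_two_succ (n j : ℕ) :
    sqCoeff (n + 2) (j + 1) = (Nat.centralBinom j : ℚ) ^ 2 * ((n + 1 + j).choose (2 * j) : ℚ)
      * ((n + 3 + j) * (n + 2 + j)) * (2 * (2 * j + 1)) / ((j + 1) ^ 3) := by
  have h := choose_shift_left n j
  rw [sqCoeff_succ_succ, show n + 1 + 1 + j = n + j + 2 by ring]
  congr 1
  push_cast
  linear_combination (Nat.centralBinom j : ℚ) ^ 2 * (n + 3 + j) * (2 * (2 * j + 1)) * h

theorem sqCoeff_succ_left (n j : ℕ) :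
    sqCoeff (n + 1) j
      = (Nat.centralBinom j : ℚ) ^ 2 * ((n + 1 + j).choose (2 * j) : ℚ) := by
  rw [sqCoeff, mul_comm]

theorem prodCoeff_succ_left (n j : ℕ) :
    prodCoeff (n + 1) j = (Nat.centralBinom j : ℚ) ^ 2 * ((n + 1 + j).choose (2 * j) : ℚ)
      * (n + 2 + j) * ((2 * n + 5) * (j + 1) - (n + 2)) / ((j + 1) ^ 2 * (n + 2) * (n + 3)) := by
  have h := choose_shift_left n j
  rw [prodCoeff, show n + 1 + 1 + j = n + j + 2 by ring]
  push_cast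
  rw [show ((n : ℚ) + 1 + 1) = n + 2 by ring, show ((n : ℚ) + 1 + 2) = n + 3 by ring]
  congr 1
  linear_combination (Nat.centralBinom j : ℚ) ^ 2 * ((2 * n + 5) * (j + 1) - (n + 2)) * h

/-- The coefficient of `t ^ (j + 1)` in the three-term recurrence multiplied by `b * T (n + 1)`; the
factor `b ^ 2 / d = 1 + 4 t` produces the `4 * sqCoeff` term. -/
theorem cross_coeff_identity (n j : ℕ) :
    (n + 2) * (sqCoeff (n + 1) (j + 1) + 2 * (n + 3) * prodCoeff (n + 1) j)
      = (2 * n + 3) * (sqCoeff (n + 1) (j + 1) + 4 * sqCoeff (n + 1) j)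
        - (n + 1) * (sqCoeff n (j + 1) + 2 * (n + 2) * prodCoeff n j) := by
  rw [sqCoeff_succ_succ, sqCoeff_succ_right, sqCoeff_succ_left, prodCoeff_succ_left, prodCoeff]
  field_simp
  ring

/-- The corresponding coefficient of the squared three-term recurrence. -/
theorem sq_coeff_identity (n j : ℕ) :
    (n + 2) ^ 2 * sqCoeff (n + 2) (j + 1)
      = (2 * n + 3) ^ 2 * (sqCoeff (n + 1) (j + 1) + 4 * sqCoeff (n + 1) j)
        + (n + 1) ^ 2 * sqCoeff n (j + 1)
        - 2 * (2 * n + 3) * (n + 1) * (sqCoeff n (j + 1) + 2 * (n + 2) * prodCoeff n j) := by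
  rw [sqCoeff_add_two_succ, sqCoeff_succ_succ, sqCoeff_succ_right, sqCoeff_succ_left, prodCoeff]
  field_simp
  ring

theorem sqCoeff_zero_right (n : ℕ) : sqCoeff n 0 = 1 := by simp [sqCoeff]

theorem sqCoeff_eq_zero {n j : ℕ} (h : n < j) : sqCoeff n j = 0 := by
  simp [sqCoeff, Nat.choose_eq_zero_of_lt (show n + j < 2 * j by omega)]

theorem prodCoeff_eq_zero {n j : ℕ} (h : n < j) : prodCoeff n j = 0 := by
  rcases (Nat.succ_le_of_lt h).eq_or_lt with rfl | h1
  · simp [prodCoeff]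
  · simp [prodCoeff, Nat.choose_eq_zero_of_lt (show n + 1 + j < 2 * j by omega)]

theorem sum_extend {f : ℕ → ℚ} {n N : ℕ} (hN : n < N) (hf : ∀ j, n < j → f j = 0) (t : ℚ) :
    ∑ j ∈ range N, f j * t ^ j = ∑ j ∈ range (n + 1), f j * t ^ j := by
  symm
  refine sum_subset (fun i hi => ?_) fun j _ hj => ?_
  · simp only [mem_range] at *; omega
  · rw [hf j (by simp only [mem_range] at hj; omega), zero_mul]

theorem mul_sum_pow_succ (f : ℕ → ℚ) (N : ℕ) (t : ℚ) :
    t * ∑ j ∈ range N, f j * t ^ j = ∑ j ∈ range N, f j * t ^ (j + 1) := by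
  rw [mul_sum]
  exact sum_congr rfl fun j _ => by ring

/-- `∑ j, sqCoeff n j * t ^ j`. -/
def sqSum (n : ℕ) (t : ℚ) : ℚ := ∑ j ∈ range (n + 1), sqCoeff n j * t ^ j

/-- `∑ j, prodCoeff n j * t ^ j`. -/
def prodSum (n : ℕ) (t : ℚ) : ℚ := ∑ j ∈ range (n + 1), prodCoeff n j * t ^ j

theorem sqSum_eq {n N : ℕ} (hN : n < N) (t : ℚ) :
    ∑ j ∈ range N, sqCoeff n j * t ^ j = sqSum n t :=
  sum_extend hN (fun _ => sqCoeff_eq_zero) t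

theorem prodSum_eq {n N : ℕ} (hN : n < N) (t : ℚ) :
    ∑ j ∈ range N, prodCoeff n j * t ^ j = prodSum n t :=
  sum_extend hN (fun _ => prodCoeff_eq_zero) t

theorem sqSum_eq_succ {n N : ℕ} (hN : n ≤ N) (t : ℚ) :
    sqSum n t = ∑ j ∈ range N, sqCoeff n (j + 1) * t ^ (j + 1) + 1 := by
  rw [← sqSum_eq (Nat.lt_succ_of_le hN), sum_range_succ']
  simp [sqCoeff_zero_right]

/-- The expansion of `b * T_n * T_{n+1} / d ^ (n + 1)`. -/
def crossSum (n : ℕ) (t : ℚ) : ℚ := sqSum n t + 2 * (n + 2) * (t * prodSum n t)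

theorem crossSum_succ (n : ℕ) (t : ℚ) :
    (n + 2) * crossSum (n + 1) t
      = (2 * n + 3) * ((1 + 4 * t) * sqSum (n + 1) t) - (n + 1) * crossSum n t := by
  have h : ∑ j ∈ range (n + 2), (n + 2) * (sqCoeff (n + 1) (j + 1) + 2 * (n + 3) * prodCoeff (n + 1) j)
        * t ^ (j + 1)
      = ∑ j ∈ range (n + 2), ((2 * n + 3) * (sqCoeff (n + 1) (j + 1) + 4 * sqCoeff (n + 1) j)
        - (n + 1) * (sqCoeff n (j + 1) + 2 * (n + 2) * prodCoeff n j)) * t ^ (j + 1) :=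
    sum_congr rfl fun j _ => by rw [cross_coeff_identity]
  simp only [add_mul, sub_mul, mul_add, mul_assoc, sum_add_distrib, sum_sub_distrib, ← mul_sum] at h
  have e1 := sqSum_eq_succ (show n + 1 ≤ n + 2 by omega) t
  have e2 := sqSum_eq_succ (show n ≤ n + 2 by omega) t
  have e3 := mul_sum_pow_succ (prodCoeff n) (n + 2) t
  have e4 := mul_sum_pow_succ (prodCoeff (n + 1)) (n + 2) t
  have e5 := mul_sum_pow_succ (sqCoeff (n + 1)) (n + 2) t
  rw [prodSum_eq (by omega)] at e3 e4
  rw [sqSum_eq (by omega)] at e5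
  rw [crossSum, crossSum]
  rw [← e3, ← e4, ← e5, ← sub_eq_iff_eq_add.mpr e1, ← sub_eq_iff_eq_add.mpr e2] at h
  push_cast
  linear_combination h

theorem sqSum_add_two (n : ℕ) (t : ℚ) :
    (n + 2) ^ 2 * sqSum (n + 2) t
      = (2 * n + 3) ^ 2 * ((1 + 4 * t) * sqSum (n + 1) t) + (n + 1) ^ 2 * sqSum n t
        - 2 * (2 * n + 3) * (n + 1) * crossSum n t := by
  have h : ∑ j ∈ range (n + 2), (n + 2) ^ 2 * sqCoeff (n + 2) (j + 1) * t ^ (j + 1)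
      = ∑ j ∈ range (n + 2), ((2 * n + 3) ^ 2 * (sqCoeff (n + 1) (j + 1) + 4 * sqCoeff (n + 1) j)
        + (n + 1) ^ 2 * sqCoeff n (j + 1)
        - 2 * (2 * n + 3) * (n + 1) * (sqCoeff n (j + 1) + 2 * (n + 2) * prodCoeff n j))
          * t ^ (j + 1) :=
    sum_congr rfl fun j _ => by rw [sq_coeff_identity]
  -- The scalar factors are made opaque so that distributing the sums does not expand them.
  generalize hα : ((n : ℚ) + 2) ^ 2 = α at h ⊢
  generalize hβ : (2 * (n : ℚ) + 3) ^ 2 = β at h ⊢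
  generalize hγ : ((n : ℚ) + 1) ^ 2 = γ at h ⊢
  generalize hδ : 2 * (2 * (n : ℚ) + 3) * (n + 1) = δ at h ⊢
  simp only [add_mul, sub_mul, mul_add, mul_assoc, sum_add_distrib, sum_sub_distrib, ← mul_sum] at h
  have e1 := sqSum_eq_succ (show n + 1 ≤ n + 2 by omega) t
  have e2 := sqSum_eq_succ (show n ≤ n + 2 by omega) t
  have e3 := mul_sum_pow_succ (prodCoeff n) (n + 2) t
  have e4 := sqSum_eq_succ (show n + 2 ≤ n + 2 by omega) t
  have e5 := mul_sum_pow_succ (sqCoeff (n + 1)) (n + 2) t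
  rw [prodSum_eq (by omega)] at e3
  rw [sqSum_eq (by omega)] at e5
  rw [crossSum]
  rw [← e3, ← e5, ← sub_eq_iff_eq_add.mpr e1, ← sub_eq_iff_eq_add.mpr e2,
    ← sub_eq_iff_eq_add.mpr e4] at h
  subst hα hβ hγ hδ
  linear_combination h

/-- Squaring the three-term recurrence creates the mixed product `T_n T_{n+1}`, so two consecutive
squares and this product must be carried through one induction. -/
theorem T_sq_expansion {b c : ℤ} {d : ℚ} (hd : d = b ^ 2 - 4 * c) (hd0 : d ≠ 0) (n : ℕ) :
    (T n b c : ℚ) ^ 2 / d ^ n = sqSum n (c / d)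
      ∧ (T (n + 1) b c : ℚ) ^ 2 / d ^ (n + 1) = sqSum (n + 1) (c / d)
      ∧ (b : ℚ) * T n b c * T (n + 1) b c / d ^ (n + 1) = crossSum n (c / d) := by
  have hb : (b : ℚ) ^ 2 = d * (1 + 4 * (c / d)) := by
    field_simp
    rw [hd]; ring
  induction n with
  | zero =>
    have h0 : sqCoeff 1 1 = 4 := by norm_num [sqCoeff, Nat.centralBinom]
    have h1 : prodCoeff 0 0 = 1 := by norm_num [prodCoeff]
    refine ⟨by simp [T_zero, sqSum, sqCoeff], ?_, ?_⟩
    · rw [zero_add, T_one, hb]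
      simp [sqSum, sum_range_succ, sqCoeff_zero_right, h0]
      field_simp
    · rw [zero_add, T_one, T_zero, Int.cast_one, mul_one, ← sq, hb]
      simp [crossSum, sqSum, prodSum, sqCoeff_zero_right, h1]
      field_simp
      ring
  | succ n ih =>
    obtain ⟨h1, h2, h3⟩ := ih
    have hrec : ((n : ℚ) + 2) * T (n + 2) b c
        = (2 * n + 3) * b * T (n + 1) b c - (n + 1) * d * T n b c := by
      have := T_three_term n b c
      rw [hd]
      exact_mod_cast this
    have hn : (n : ℚ) + 2 ≠ 0 := by positivity
    refine ⟨h2, ?_, ?_⟩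
    · refine mul_left_cancel₀ (pow_ne_zero 2 hn) ?_
      have e := sqSum_add_two n (c / d)
      rw [show n + 1 + 1 = n + 2 from rfl, e, ← h1, ← h2, ← h3, ← mul_div_assoc, ← mul_pow, hrec,
        show (1 + 4 * (c / d)) = (b : ℚ) ^ 2 / d by rw [hb]; field_simp]
      field_simp
      ring
    · refine mul_left_cancel₀ hn ?_
      have e := crossSum_succ n (c / d)
      rw [show n + 1 + 1 = n + 2 from rfl, e, ← h2, ← h3,
        show (1 + 4 * (c / d)) = (b : ℚ) ^ 2 / d by rw [hb]; field_simp,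
        show ((n : ℚ) + 2) * (b * T (n + 1) b c * T (n + 2) b c / d ^ (n + 2))
          = b * T (n + 1) b c * (((n : ℚ) + 2) * T (n + 2) b c) / d ^ (n + 2) by ring, hrec]
      field_simp
      ring

theorem T_mul_M_expansion {b c : ℤ} {d : ℚ} (hd : d = b ^ 2 - 4 * c) (hd0 : d ≠ 0) (hc : c ≠ 0)
    (n : ℕ) : (T n b c : ℚ) * M n b c / d ^ n = prodSum n (c / d) := by
  obtain ⟨h1, -, h3⟩ := T_sq_expansion hd hd0 n
  have hM : 2 * ((n : ℚ) + 2) * c * M n b c = b * T (n + 1) b c - d * T n b c := by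
    have := two_mul_M n b c
    rw [hd]
    exact_mod_cast this
  have hc' : (c : ℚ) ≠ 0 := by exact_mod_cast hc
  have hn : (n : ℚ) + 2 ≠ 0 := by positivity
  have h4 : 2 * ((n : ℚ) + 2) * (c / d) ≠ 0 := by positivity
  refine mul_left_cancel₀ h4 ?_
  rw [crossSum, ← h1] at h3
  have h5 : 2 * ((n : ℚ) + 2) * (c / d) * prodSum n (c / d)
      = b * T n b c * T (n + 1) b c / d ^ (n + 1) - (T n b c : ℚ) ^ 2 / d ^ n := by
    rw [h3]; ring
  rw [h5, show 2 * ((n : ℚ) + 2) * (c / d) * (T n b c * M n b c / d ^ n)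
    = (2 * ((n : ℚ) + 2) * c * M n b c) * T n b c / d ^ (n + 1) by field_simp; ring, hM]
  field_simp
  ring

theorem partialCoeff_rat (n j : ℕ) :
    (partialCoeff n j : ℚ) = (Nat.centralBinom j : ℚ) ^ 2 * ((n + 1 + j).choose (2 * j) : ℚ)
      * ((n - j) * (n + 1 - j)) / ((j + 1) ^ 2 * (n + 1)) := by
  have h1 := choose_succ_mul (R := ℚ) n j
  have h2 : (n.choose j : ℚ) * (n + 1) = (n + 1).choose j * (n + 1 - j) := by
    by_cases h : j ≤ n + 1
    · have := Nat.choose_mul_succ_eq n j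
      have h3 : ((n + 1 - j : ℕ) : ℚ) = n + 1 - j := by rw [Nat.cast_sub h]; push_cast; ring
      rw [← h3]
      exact_mod_cast this
    · simp [Nat.choose_eq_zero_of_lt (show n < j by omega),
        Nat.choose_eq_zero_of_lt (not_le.mp h)]
  have h3 : ((n + 1 + j).choose (2 * j) : ℚ) * Nat.centralBinom j
      = (n + 1 + j).choose j * (n + 1).choose j := by
    have := Nat.choose_mul (n := n + 1 + j) (k := 2 * j) (s := j) (by omega)
    rw [show n + 1 + j - j = n + 1 by omega, show 2 * j - j = j by omega] at this
    exact_mod_cast this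
  have h4 : ((j : ℚ) + 1) * catalan j = Nat.centralBinom j := by
    exact_mod_cast succ_mul_catalan_eq_centralBinom j
  rw [partialCoeff, eq_div_iff (by positivity), ← h4, show n + j + 1 = n + 1 + j by ring]
  rw [← h4] at h3
  push_cast
  linear_combination ((n + 1 + j).choose j : ℚ) * catalan j * (j + 1) * (n + 1) * h1
    + ((n + 1 + j).choose j : ℚ) * catalan j * (j + 1) * (n - j) * h2
    - catalan j * (j + 1) * (n - j) * (n + 1 - j) * h3

/-- The telescoping step: `partialCoeff` is a discrete antiderivative in `n` of the coefficients of
`T_n M_n / d ^ n`. -/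
theorem partialCoeff_succ_sub (n j : ℕ) :
    (partialCoeff (n + 1) j : ℚ) - partialCoeff n j = prodCoeff n j := by
  have h := choose_shift_left n j
  rw [partialCoeff_rat, partialCoeff_rat, prodCoeff, show n + 1 + 1 + j = n + j + 2 by ring]
  push_cast
  rw [show ((n : ℚ) + 1 + 1) = n + 2 by ring]
  have h' : (Nat.centralBinom j : ℚ) ^ 2 * ((n + j + 2).choose (2 * j) : ℚ)
        * ((n + 1 - j) * (n + 2 - j)) = (Nat.centralBinom j : ℚ) ^ 2
          * ((n + 1 + j).choose (2 * j) : ℚ) * (n + 1 - j) * (n + 2 + j) := by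
    linear_combination (Nat.centralBinom j : ℚ) ^ 2 * (n + 1 - j) * h
  rw [h']
  field_simp
  ring

theorem sum_T_mul_M {b c : ℤ} {d : ℚ} (hd : d = b ^ 2 - 4 * c) (hd0 : d ≠ 0) (hc : c ≠ 0)
    (n : ℕ) : ∑ k ∈ range n, (T k b c : ℚ) * M k b c / d ^ k
      = ∑ j ∈ range n, (partialCoeff n j : ℚ) * (c / d) ^ j := by
  induction n with
  | zero => simp
  | succ n ih =>
    have h0 : partialCoeff n n = 0 := by simp [partialCoeff]
    rw [sum_range_succ, ih, T_mul_M_expansion hd hd0 hc, prodSum]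
    simp only [← partialCoeff_succ_sub, sub_mul, sum_sub_distrib]
    rw [sum_range_succ (fun j => (partialCoeff n j : ℚ) * (c / d) ^ j), h0]
    simp

/-! ### Integrality of `w` and the partial sums -/

/-- The integer `w(n, j + 1)`. -/
def wInt (n j : ℕ) : ℤ :=
  ((n - 1).choose j : ℤ) * (n + j + 1).choose (j + 1) - (n.choose (j + 1) : ℤ) * (n + j + 1).choose j

/-- Absorbing `j + 1` into each product of binomials gives `(n + 1) - n = 1` times the right-hand
side; this is why the integer `wInt` equals the fraction `w`. -/
theorem succ_mul_wInt {n : ℕ} (hn : 0 < n) (j : ℕ) :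
    ((j : ℤ) + 1) * wInt n j = (n - 1).choose j * (n + j + 1).choose j := by
  obtain ⟨m, rfl⟩ := Nat.exists_eq_succ_of_ne_zero hn.ne'
  have h1 : ((m : ℤ) + 1) * m.choose j = (m + 1).choose (j + 1) * (j + 1) := by
    exact_mod_cast Nat.add_one_mul_choose_eq m j
  have h2 := choose_succ_mul (R := ℤ) (m + 1 + j + 1) j
  simp only [wInt, Nat.succ_eq_add_one, Nat.add_sub_cancel]
  push_cast at h2
  linear_combination (m.choose j : ℤ) * h2 + ((m + 1 + j + 1).choose j : ℤ) * h1

theorem mul_wInt {n : ℕ} (hn : 0 < n) (j : ℕ) :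
    (n : ℤ) * wInt n j = n.choose (j + 1) * (n + j + 1).choose j := by
  have h := succ_mul_wInt hn j
  obtain ⟨m, rfl⟩ := Nat.exists_eq_succ_of_ne_zero hn.ne'
  have h1 : ((m : ℤ) + 1) * m.choose j = (m + 1).choose (j + 1) * (j + 1) := by
    exact_mod_cast Nat.add_one_mul_choose_eq m j
  have hj : ((j : ℤ) + 1) ≠ 0 := by positivity
  refine mul_left_cancel₀ hj ?_
  simp only [Nat.succ_eq_add_one, Nat.add_sub_cancel] at h ⊢
  push_cast
  linear_combination ((m : ℤ) + 1) * h + ((m + 1 + j + 1).choose j : ℤ) * h1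

theorem w_succ {n : ℕ} (hn : 0 < n) (j : ℕ) : w n (j + 1) = wInt n j := by
  have h : ((j : ℚ) + 1) * wInt n j = (n - 1).choose j * (n + j + 1).choose j := by
    exact_mod_cast succ_mul_wInt hn j
  rw [w, Nat.add_sub_cancel, ← add_assoc]
  push_cast
  rw [mul_assoc, ← h]
  field_simp

theorem sum_Icc_w {n : ℕ} (hn : 0 < n) (f : ℕ → ℚ) :
    ∑ k ∈ Icc 1 n, w n k * f (k - 1) = ∑ j ∈ range n, (wInt n j : ℚ) * f j := by
  rw [← Ico_add_one_right_eq_Icc, sum_Ico_eq_sum_range]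
  refine sum_congr rfl fun j _ => ?_
  rw [add_comm 1 j, w_succ hn, Nat.add_sub_cancel]

theorem sum_T_mul_M_eq_mul {b c : ℤ} {d : ℚ} (hd : d = b ^ 2 - 4 * c) (hd0 : d ≠ 0) (hc : c ≠ 0)
    {n : ℕ} (hn : 0 < n) : ∑ k ∈ range n, (T k b c : ℚ) * M k b c / d ^ k
      = n * ∑ j ∈ range n, (wInt n j : ℚ) * catalan j * (c / d) ^ j := by
  rw [sum_T_mul_M hd hd0 hc, mul_sum]
  refine sum_congr rfl fun j _ => ?_
  have h : (n : ℚ) * wInt n j = n.choose (j + 1) * (n + j + 1).choose j := by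
    exact_mod_cast mul_wInt hn j
  rw [partialCoeff]
  push_cast
  rw [← h]
  ring

theorem sum_T_mul_M_one_one {n : ℕ} (hn : 0 < n) :
    ∑ k ∈ range n, (T k 1 1 : ℚ) * M k 1 1 * (-3) ^ (n - 1 - k)
      = n * ∑ j ∈ range n, (wInt n j : ℚ) * catalan j * (-3) ^ (n - 1 - j) := by
  have h := sum_T_mul_M_eq_mul (b := 1) (c := 1) (d := -3) (by norm_num) (by norm_num)
    (by norm_num) hn
  have hpow : ∀ j ∈ range n, (-3 : ℚ) ^ (n - 1 - j) = (-3) ^ (n - 1) / (-3) ^ j := fun j hj => by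
    have : j ≤ n - 1 := by simp only [mem_range] at hj; omega
    rw [pow_sub₀ _ (by norm_num) this, div_eq_mul_inv]
  have h1 : ∑ k ∈ range n, (T k 1 1 : ℚ) * M k 1 1 * (-3) ^ (n - 1 - k)
      = (-3) ^ (n - 1) * ∑ k ∈ range n, (T k 1 1 : ℚ) * M k 1 1 / (-3) ^ k := by
    rw [mul_sum]
    exact sum_congr rfl fun k hk => by rw [hpow k hk]; ring
  have h2 : ∑ j ∈ range n, (wInt n j : ℚ) * catalan j * (-3) ^ (n - 1 - j)
      = (-3) ^ (n - 1) * ∑ j ∈ range n, (wInt n j : ℚ) * catalan j * ((1 : ℤ) / (-3)) ^ j := by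
    rw [mul_sum]
    exact sum_congr rfl fun k hk => by rw [hpow k hk, Int.cast_one, div_pow, one_pow]; ring
  rw [h1, h2, h]
  ring

theorem sum_T_mul_M_div_one_one {n : ℕ} (hn : 0 < n) :
    ∑ k ∈ range n, (T k 1 1 : ℚ) * M k 1 1 / (-3) ^ k
      = n * (∑ j ∈ range n, (wInt n j : ℚ) * catalan j * (-3) ^ (n - 1 - j)) / (-3) ^ (n - 1) := by
  rw [← sum_T_mul_M_one_one hn, sum_div]
  refine sum_congr rfl fun k hk => ?_
  have : n - 1 = k + (n - 1 - k) := by simp only [mem_range] at hk; omega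
  nth_rw 2 [this]
  rw [pow_add]
  field_simp

theorem sum_T_mul_M_three_three {n : ℕ} (hn : 0 < n) :
    ∑ k ∈ range n, (T k 3 3 : ℚ) * M k 3 3 / (-3) ^ k
      = n * ∑ j ∈ range n, (wInt n j : ℚ) * catalan j * (-1) ^ j := by
  have h := sum_T_mul_M_eq_mul (b := 3) (c := 3) (d := -3) (by norm_num) (by norm_num)
    (by norm_num) hn
  rw [h]
  norm_num

theorem average_one_one {n : ℕ} (hn : 0 < n) :
    (1 / (n : ℚ)) * ∑ k ∈ range n, (T k 1 1 : ℚ) * (M k 1 1 : ℚ) * (-3 : ℚ) ^ (n - 1 - k)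
          = ∑ k ∈ Icc 1 n, w n k * (catalan (k - 1) : ℚ) * (-3 : ℚ) ^ (n - k)
        ∧ ∃ z : ℤ, (1 / (n : ℚ)) * ∑ k ∈ range n,
            (T k 1 1 : ℚ) * (M k 1 1 : ℚ) * (-3 : ℚ) ^ (n - 1 - k) = (z : ℚ) := by
  have hn' : (n : ℚ) ≠ 0 := by positivity
  have h : (1 / (n : ℚ)) * ∑ k ∈ range n, (T k 1 1 : ℚ) * (M k 1 1 : ℚ) * (-3 : ℚ) ^ (n - 1 - k)
      = ∑ j ∈ range n, (wInt n j : ℚ) * (catalan j * (-3) ^ (n - 1 - j)) := by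
    rw [sum_T_mul_M_one_one hn, ← mul_assoc, one_div_mul_cancel hn', one_mul]
    exact sum_congr rfl fun _ _ => by ring
  refine ⟨?_, ∑ j ∈ range n, wInt n j * (catalan j * (-3) ^ (n - 1 - j)), ?_⟩
  · rw [h, ← sum_Icc_w hn]
    refine sum_congr rfl fun k hk => ?_
    rw [show n - 1 - (k - 1) = n - k by simp only [mem_Icc] at hk; omega]
    ring
  · rw [h]; push_cast; rfl

theorem average_three_three {n : ℕ} (hn : 0 < n) :
    (1 / (n : ℚ)) * ∑ k ∈ range n, (T k 3 3 : ℚ) * (M k 3 3 : ℚ) / (-3 : ℚ) ^ k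
          = ∑ k ∈ Icc 1 n, (-1 : ℚ) ^ (k - 1) * w n k * (catalan (k - 1) : ℚ)
        ∧ ∃ z : ℤ, (1 / (n : ℚ)) * ∑ k ∈ range n,
            (T k 3 3 : ℚ) * (M k 3 3 : ℚ) / (-3 : ℚ) ^ k = (z : ℚ) := by
  have hn' : (n : ℚ) ≠ 0 := by positivity
  have h : (1 / (n : ℚ)) * ∑ k ∈ range n, (T k 3 3 : ℚ) * (M k 3 3 : ℚ) / (-3 : ℚ) ^ k
      = ∑ j ∈ range n, (wInt n j : ℚ) * (catalan j * (-1) ^ j) := by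
    rw [sum_T_mul_M_three_three hn, ← mul_assoc, one_div_mul_cancel hn', one_mul]
    exact sum_congr rfl fun _ _ => by ring
  refine ⟨?_, ∑ j ∈ range n, wInt n j * (catalan j * (-1) ^ j), ?_⟩
  · rw [h, ← sum_Icc_w hn]
    exact sum_congr rfl fun _ _ => by ring
  · rw [h]; push_cast; rfl

/-! ### Binomial sums against a second-order recurrence -/

theorem sum_choose_succ {R : Type*} [CommRing R] (n : ℕ) (f : ℕ → R) :
    ∑ k ∈ range (n + 2), ((n + 1).choose k : R) * f k
      = ∑ k ∈ range (n + 1), (n.choose k : R) * (f k + f (k + 1)) := by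
  rw [sum_choose_succ_mul (fun i _ => f i) n, ← sum_add_distrib]
  exact sum_congr rfl fun _ _ => by ring

/-- The shift operator `E` satisfies `(1 + E) ^ 2 = m E` on `v`, hence `(1 + E) ^ (2h + 1) = m ^ h *
E ^ h * (1 + E)`. -/
theorem sum_choose_mul_recurrence {R : Type*} [CommRing R] {m : R} {v : ℕ → R}
    (hv : ∀ k, v (k + 2) = (m - 2) * v (k + 1) - v k) (h i : ℕ) :
    ∑ k ∈ range (2 * h + 2), ((2 * h + 1).choose k : R) * v (k + i)
      = m ^ h * (v (h + i) + v (h + i + 1)) := by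
  induction h generalizing i with
  | zero => simp [sum_range_succ, add_comm 1 i]
  | succ h ih =>
    have step : ∀ n, ∑ k ∈ range (n + 3), ((n + 2).choose k : R) * v (k + i)
        = m * ∑ k ∈ range (n + 1), (n.choose k : R) * v (k + (i + 1)) := fun n => by
      rw [sum_choose_succ (n + 1) fun k => v (k + i),
        sum_choose_succ n fun k => v (k + i) + v (k + 1 + i), mul_sum]
      refine sum_congr rfl fun k _ => ?_
      rw [show k + 1 + 1 + i = k + i + 2 by ring, show k + 1 + i = k + i + 1 by ring, hv,
        show k + (i + 1) = k + i + 1 by ring]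
      ring
    rw [show 2 * (h + 1) + 2 = 2 * h + 1 + 3 by ring, show 2 * (h + 1) + 1 = 2 * h + 1 + 2 by ring,
      step, ih, show h + (i + 1) = h + 1 + i by ring]
    ring

theorem catalan_eq_choose_sub (n : ℕ) :
    (catalan n : ℤ) = (2 * n).choose n - (2 * n).choose (n + 1) := by
  have h1 : ((n : ℤ) + 1) * catalan n = (2 * n).choose n := by
    exact_mod_cast succ_mul_catalan_eq_centralBinom n
  have h2 := choose_succ_mul (R := ℤ) (2 * n) n
  have h3 : ((n : ℤ) + 1) ≠ 0 := by positivity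
  refine mul_left_cancel₀ h3 ?_
  push_cast at h2
  linear_combination h1 + h2

theorem choose_add_two (N k : ℕ) :
    (N + 2).choose (k + 2) = N.choose k + 2 * N.choose (k + 1) + N.choose (k + 2) := by
  rw [Nat.choose_succ_succ' (N + 1) (k + 1), Nat.choose_succ_succ' N k,
    Nat.choose_succ_succ' N (k + 1)]
  ring

/-- Two Pascal steps in the binomial match `m v_{j+1} = v_{j+2} + 2 v_{j+1} + v_j`. The boundary
contributes `binom(2n, n) v_1 - binom(2n, n+1) v_0`, which is exactly the new Catalan number. -/
theorem sum_catalan_eq {R : Type*} [CommRing R] {m : R} {v : ℕ → R} (h0 : v 0 = 1) (h1 : v 1 = 1)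
    (hv : ∀ k, v (k + 2) = (m - 2) * v (k + 1) - v k) {n N : ℕ} (hN : n ≤ N) :
    ∑ k ∈ range n, (catalan k : R) * m ^ (n - 1 - k)
      = ∑ j ∈ range N, ((2 * n).choose (n + 1 + j) : R) * v (j + 1) := by
  induction n generalizing N with
  | zero =>
    rw [range_zero, sum_empty]
    exact (sum_eq_zero fun j _ => by simp [Nat.choose_eq_zero_of_lt (show 0 < 0 + 1 + j by omega)]).symm
  | succ n ih =>
    obtain ⟨N, rfl⟩ := Nat.exists_eq_succ_of_ne_zero (show N ≠ 0 by omega)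
    have hl : ∑ k ∈ range (n + 1), (catalan k : R) * m ^ (n + 1 - 1 - k)
        = m * (∑ k ∈ range n, (catalan k : R) * m ^ (n - 1 - k)) + catalan n := by
      rw [sum_range_succ, mul_sum]
      congr 1
      · refine sum_congr rfl fun k hk => ?_
        rw [show n + 1 - 1 - k = (n - 1 - k) + 1 by simp only [mem_range] at hk; omega]
        ring
      · simp
    have hz : ∀ i, n < i → (2 * n).choose (n + i) = 0 := fun i hi =>
      Nat.choose_eq_zero_of_lt (by omega)
    have hP : ∀ j, (((2 * (n + 1)).choose (n + 1 + 1 + j) : ℕ) : R)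
        = (2 * n).choose (n + j) + 2 * (2 * n).choose (n + 1 + j) + (2 * n).choose (n + 2 + j) := by
      intro j
      rw [show 2 * (n + 1) = 2 * n + 2 by ring, show n + 1 + 1 + j = n + j + 2 by ring,
        choose_add_two, show n + 1 + j = n + j + 1 by ring]
      push_cast
      rfl
    have hc : (catalan n : R) = (2 * n).choose n - (2 * n).choose (n + 1) := by
      exact_mod_cast congrArg (Int.cast : ℤ → R) (catalan_eq_choose_sub n)
    rw [hl, ih (show n ≤ N + 1 by omega), hc]
    simp only [hP, add_mul, sum_add_distrib]
    have s1 : ∑ j ∈ range (N + 1), ((2 * n).choose (n + j) : R) * v (j + 1)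
        = ∑ j ∈ range (N + 1), ((2 * n).choose (n + 1 + j) : R) * v (j + 2) + (2 * n).choose n := by
      have e : ∑ j ∈ range (N + 1), ((2 * n).choose (n + 1 + j) : R) * v (j + 2)
          = ∑ j ∈ range N, ((2 * n).choose (n + 1 + j) : R) * v (j + 2) := by
        rw [sum_range_succ, show n + 1 + N = n + (N + 1) by ring, hz (N + 1) (by omega)]
        simp
      rw [e, sum_range_succ']
      simp only [add_zero, zero_add, h1, mul_one]
      congr 1
      exact sum_congr rfl fun j _ => by rw [show n + (j + 1) = n + 1 + j by ring]
    have s2 : ∑ j ∈ range (N + 1), ((2 * n).choose (n + 2 + j) : R) * v (j + 1)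
        = ∑ j ∈ range (N + 1), ((2 * n).choose (n + 1 + j) : R) * v j - (2 * n).choose (n + 1) := by
      have e : ∑ j ∈ range (N + 1), ((2 * n).choose (n + 2 + j) : R) * v (j + 1)
          = ∑ j ∈ range N, ((2 * n).choose (n + 2 + j) : R) * v (j + 1) := by
        rw [sum_range_succ, show n + 2 + N = n + (N + 2) by ring, hz (N + 2) (by omega)]
        simp
      rw [e, sum_range_succ']
      simp only [add_zero, h0, mul_one, add_sub_cancel_right]
      exact sum_congr rfl fun j _ => by rw [show n + 1 + (j + 1) = n + 2 + j by ring]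
    have s3 : ∑ j ∈ range (N + 1), ((2 * n).choose (n + 1 + j) : R) * v (j + 2)
        = (m - 2) * ∑ j ∈ range (N + 1), ((2 * n).choose (n + 1 + j) : R) * v (j + 1)
          - ∑ j ∈ range (N + 1), ((2 * n).choose (n + 1 + j) : R) * v j := by
      rw [mul_sum, ← sum_sub_distrib]
      exact sum_congr rfl fun j _ => by rw [hv]; ring
    rw [s1, s2, s3]
    simp only [mul_assoc, ← mul_sum]
    ring

/-! ### Binomial coefficients modulo `p ^ 2` -/

theorem natCast_mul_self_sq (p : ℕ) : (p : ZMod (p ^ 2)) * p = 0 := by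
  have := ZMod.natCast_self (p ^ 2)
  rw [← sq]
  exact_mod_cast this

theorem natCast_mul_eq_zero {p a b : ℕ} (ha : p ∣ a) (hb : p ∣ b) :
    (a : ZMod (p ^ 2)) * b = 0 := by
  obtain ⟨a, rfl⟩ := ha
  obtain ⟨b, rfl⟩ := hb
  push_cast
  linear_combination (a : ZMod (p ^ 2)) * b * natCast_mul_self_sq p

theorem isUnit_natCast_sq {p k : ℕ} (hp : p.Prime) (hk : ¬ p ∣ k) : IsUnit (k : ZMod (p ^ 2)) := by
  rw [ZMod.isUnit_iff_coprime]
  exact ((hp.coprime_iff_not_dvd.mpr hk).symm).pow_right 2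

theorem isUnit_succ {p j : ℕ} (hp : p.Prime) (hj : j + 1 < p) :
    IsUnit ((j : ZMod (p ^ 2)) + 1) := by
  exact_mod_cast isUnit_natCast_sq hp (Nat.not_dvd_of_pos_of_lt (Nat.succ_pos j) hj)

theorem prime_mul_choose_pred {p k : ℕ} (hp : p.Prime) (hk : k < p) :
    (p : ZMod (p ^ 2)) * (p - 1).choose k = (-1) ^ k * p := by
  induction k with
  | zero => simp
  | succ k ih =>
    have h1 := ih (by omega)
    have h2 : p.choose (k + 1) = (p - 1).choose k + (p - 1).choose (k + 1) := by
      conv_lhs => rw [show p = (p - 1) + 1 by omega]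
      exact Nat.choose_succ_succ' _ _
    have h3 := natCast_mul_eq_zero dvd_rfl (hp.dvd_choose_self (Nat.succ_ne_zero k) hk)
    rw [Nat.succ_eq_add_one, h2] at h3
    push_cast at h3
    linear_combination h3 - h1

theorem succ_mul_choose_prime {p j : ℕ} (hp : p.Prime) (hj : j + 1 ≤ p) :
    ((j : ZMod (p ^ 2)) + 1) * p.choose (j + 1) = (-1) ^ j * p := by
  rw [← prime_mul_choose_pred hp hj]
  have := Nat.add_one_mul_choose_eq (p - 1) j
  rw [Nat.sub_add_cancel hp.one_le] at this
  have h2 := congrArg (Nat.cast : ℕ → ZMod (p ^ 2)) this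
  push_cast at h2
  linear_combination -h2

/-- In Vandermonde's convolution every term other than the two extreme ones is a product of two
multiples of `p`. -/
theorem choose_two_mul_prime {p i : ℕ} (hp : p.Prime) (h0 : 0 < i) (hi : i ≤ p) :
    ((2 * p).choose i : ZMod (p ^ 2)) = 2 * p.choose i := by
  obtain ⟨i, rfl⟩ := Nat.exists_eq_succ_of_ne_zero h0.ne'
  rw [two_mul, Nat.add_choose_eq, Finset.Nat.sum_antidiagonal_eq_sum_range_succ_mk, Nat.cast_sum,
    sum_range_succ, sum_range_succ', sum_eq_zero]
  · simp
    ring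
  · intro k hk
    simp only [mem_range] at hk
    rw [Nat.cast_mul]
    exact natCast_mul_eq_zero (hp.dvd_choose_self (by omega) (by omega))
      (hp.dvd_choose_self (by omega) (by omega))

theorem centralBinom_prime {p : ℕ} (hp : p.Prime) : (p.centralBinom : ZMod (p ^ 2)) = 2 := by
  rw [Nat.centralBinom, choose_two_mul_prime hp hp.pos le_rfl]
  simp

/-- Up to sign the product is `(j + 1) ∏ (1 - p/i) ∏ (1 + p/i)`, with `i` in `1..j` and `2..j+1`.
Paired factors are `1 - p²/i² ≡ 1`, and the factor `p + 1` cancels the unpaired `1 - p`. -/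
theorem succ_mul_choose_mul_choose {p j : ℕ} (hp : p.Prime) (hj : j < p) :
    ((p : ZMod (p ^ 2)) + 1) * ((p - 1).choose j * (p + j + 1).choose j)
      = (-1) ^ j * (p + j + 1) := by
  induction j with
  | zero => simp
  | succ j ih =>
    have h1 := ih (by omega)
    have h2 := choose_succ_mul (R := ZMod (p ^ 2)) (p - 1) j
    have h3 : (((j : ℕ) : ZMod (p ^ 2)) + 1) * (p + (j + 1) + 1).choose (j + 1)
        = (p + j + 2) * (p + j + 1).choose j := by
      have := congrArg (Nat.cast : ℕ → ZMod (p ^ 2)) (Nat.add_one_mul_choose_eq (p + j + 1) j)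
      push_cast at this
      rw [show p + (j + 1) + 1 = p + j + 1 + 1 by ring]
      linear_combination -this
    have hu := isUnit_succ hp hj
    refine hu.mul_left_cancel (hu.mul_left_cancel ?_)
    rw [Nat.cast_sub hp.one_le] at h2
    push_cast at h2 ⊢
    have hpp := natCast_mul_self_sq p
    rw [pow_succ (-1 : ZMod (p ^ 2))]
    linear_combination ((p : ZMod (p ^ 2)) + 1) * (j + 1) * (p + (j + 1) + 1).choose (j + 1) * h2
      + (p + 1) * (p - 1).choose j * (p - 1 - j) * h3
      + (p - 1 - j) * (p + j + 2) * h1 + (-1) ^ j * (p + j + 2) * hpp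

theorem succ_mul_wInt_prime {p j : ℕ} (hp : p.Prime) (hj : j < p) :
    ((p : ZMod (p ^ 2)) + 1) * ((j + 1) * wInt p j) = (-1) ^ j * (p + j + 1) := by
  rw [← succ_mul_choose_mul_choose hp hj]
  have := congrArg (Int.cast : ℤ → ZMod (p ^ 2)) (succ_mul_wInt hp.pos j)
  push_cast at this
  rw [this]

/-- The correction `p * catalan j / (j + 1)` is traded for a binomial term, using `centralBinom
(j+1) = 2 (2j+1) catalan j` and `(j+1) binom(p, j+1) ≡ (-1)^j p`. -/
theorem wInt_mul_catalan {p j : ℕ} (hp : p.Prime) (hj : j + 1 < p) :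
    2 * ((p : ZMod (p ^ 2)) + 1) * ((-1) ^ j * wInt p j * catalan j)
      = 2 * (1 + 2 * p) * catalan j
        + (-1) ^ (j + 1) * p.choose (j + 1) * (j + 1).centralBinom := by
  have h1 := succ_mul_wInt_prime hp (show j < p by omega)
  have h2 := succ_mul_choose_prime hp hj.le
  have h3 := congrArg (Int.cast : ℤ → ZMod (p ^ 2)) (centralBinom_succ_eq j)
  have h4 : ((-1 : ZMod (p ^ 2)) ^ j) * (-1) ^ j = 1 := by rw [← mul_pow]; simp
  refine (isUnit_succ hp hj).mul_left_cancel ?_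
  push_cast at h3
  rw [h3, pow_succ (-1 : ZMod (p ^ 2))]
  linear_combination 2 * (-1) ^ j * (catalan j : ZMod (p ^ 2)) * h1
    + (-1) ^ j * (2 * (2 * j + 1)) * (catalan j : ZMod (p ^ 2)) * h2
    + (catalan j : ZMod (p ^ 2)) * (2 * (p + j + 1) + p * (2 * (2 * j + 1))) * h4

theorem catalan_pred_prime {p : ℕ} (hp : p.Prime) (h2 : p ≠ 2) :
    (catalan (p - 1) : ZMod (p ^ 2)) = -(1 + 2 * p) := by
  have h := congrArg (Int.cast : ℤ → ZMod (p ^ 2)) (centralBinom_succ_eq (p - 1))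
  rw [Nat.sub_add_cancel hp.one_le] at h
  push_cast [Nat.cast_sub hp.one_le] at h
  rw [centralBinom_prime hp] at h
  have hu : IsUnit (2 : ZMod (p ^ 2)) := by
    exact_mod_cast isUnit_natCast_sq (k := 2) hp fun h =>
      h2 ((Nat.prime_dvd_prime_iff_eq hp Nat.prime_two).mp h)
  refine hu.mul_left_cancel ?_
  linear_combination (1 + 2 * (p : ZMod (p ^ 2))) * h
    + 8 * catalan (p - 1) * natCast_mul_self_sq p

theorem wInt_prime_pred {p : ℕ} (hp : p.Prime) :
    (wInt p (p - 1) : ZMod (p ^ 2)) = 2 * (1 - p) := by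
  obtain ⟨q, rfl⟩ : ∃ q, p = q + 1 := ⟨p - 1, (Nat.sub_add_cancel hp.one_le).symm⟩
  have hq : 0 < q := by have := hp.two_le; omega
  have h1 := choose_two_mul_prime hp hp.pos le_rfl
  have h2 := choose_two_mul_prime hp hq (Nat.le_succ q)
  rw [wInt, Nat.add_sub_cancel, show q + 1 + q + 1 = 2 * (q + 1) by ring]
  push_cast at h1 h2 ⊢
  rw [h1, h2]
  simp
  ring

/-! ### Central trinomial coefficients modulo `p ^ 2` -/

/-- Expand the `n`-th power of `x² + (2 - m) x + 1 = (1 + x)² - m x`. -/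
theorem sum_choose_mul_centralBinom (n : ℕ) (m : ℤ) :
    ∑ k ∈ range (n + 1), (-1) ^ k * (n.choose k : ℤ) * (k.centralBinom : ℤ) * m ^ (n - k)
      = (-1) ^ n * T n (2 - m) 1 := by
  have h : (Polynomial.X ^ 2 + Polynomial.C (2 - m) * Polynomial.X + Polynomial.C 1 : Polynomial ℤ)
      = (1 + Polynomial.X) ^ 2 + Polynomial.C (-m) * Polynomial.X := by
    simp only [map_sub, map_neg, map_ofNat, map_one]
    ring
  rw [T, h, add_pow, Polynomial.finsetSum_coeff, mul_sum]
  refine sum_congr rfl fun k hk => ?_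
  have hk' : k ≤ n := by simpa [Nat.lt_succ_iff] using hk
  have h2 : ((1 + Polynomial.X : Polynomial ℤ) ^ 2) ^ k
      * (Polynomial.C (-m) * Polynomial.X) ^ (n - k) * (n.choose k : Polynomial ℤ)
      = ((1 + Polynomial.X : Polynomial ℤ) ^ (2 * k)
        * Polynomial.C ((n.choose k : ℤ) * (-m) ^ (n - k))) * Polynomial.X ^ (n - k) := by
    simp only [mul_pow, pow_mul, Polynomial.C_mul, Polynomial.C_pow, map_natCast]
    ring
  have h3 : (((1 + Polynomial.X : Polynomial ℤ) ^ 2) ^ k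
      * (Polynomial.C (-m) * Polynomial.X) ^ (n - k) * (n.choose k : Polynomial ℤ)).coeff n
      = (k.centralBinom : ℤ) * ((n.choose k : ℤ) * (-m) ^ (n - k)) := by
    rw [h2]
    conv_lhs => rw [show n = k + (n - k) by omega]
    simp only [Nat.add_sub_cancel_left]
    rw [Polynomial.coeff_mul_X_pow, Polynomial.coeff_mul_C, Polynomial.coeff_one_add_X_pow,
      Nat.add_sub_cancel' hk']
    rfl
  have h4 : (-1 : ℤ) ^ n = (-1) ^ k * (-1) ^ (n - k) := by
    rw [← pow_add, Nat.add_sub_cancel' hk']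
  have h5 : ((-1 : ℤ) ^ (n - k)) * (-m) ^ (n - k) = m ^ (n - k) := by rw [← mul_pow]; simp
  rw [h3, h4]
  linear_combination -(-1) ^ k * (n.choose k : ℤ) * (k.centralBinom : ℤ) * h5

theorem T_neg_left (n : ℕ) (b c : ℤ) : T n (-b) c = (-1) ^ n * T n b c := by
  rw [T_eq_sum (N := n + 1) _ _ (by omega), T_eq_sum (N := n + 1) _ _ (by omega), mul_sum]
  refine sum_congr rfl fun k _ => ?_
  by_cases h : 2 * k ≤ n
  · have h1 : (-1 : ℤ) ^ n = (-1) ^ (n - 2 * k) := by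
      conv_lhs => rw [← Nat.sub_add_cancel h, pow_add, pow_mul]
      simp
    rw [neg_pow, h1]
    ring
  · simp [Nat.choose_eq_zero_of_lt (not_le.mp h)]

/-- For `2k < p`, both `2k * binom(p, 2k)` and `(-1)^k k * binom(p, k)` are `-p`. For `2k > p` the
left side vanishes and `p` divides both binomials on the right. -/
theorem two_mul_choose_mul_centralBinom {p k : ℕ} (hp : p.Prime) (h2 : p ≠ 2) (h0 : 0 < k)
    (hk : k < p) : 2 * ((p.choose (2 * k) : ZMod (p ^ 2)) * k.centralBinom)
      = (-1) ^ k * p.choose k * k.centralBinom := by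
  obtain ⟨j, rfl⟩ := Nat.exists_eq_succ_of_ne_zero h0.ne'
  rcases lt_or_ge (2 * (j + 1)) p with h | h
  · have e1 := succ_mul_choose_prime (j := j) hp hk.le
    have e2 := succ_mul_choose_prime (j := 2 * j + 1) hp (by omega)
    have h4 : ((-1 : ZMod (p ^ 2)) ^ j) * (-1) ^ j = 1 := by rw [← mul_pow]; simp
    refine (isUnit_succ hp hk).mul_left_cancel ?_
    rw [pow_succ (-1 : ZMod (p ^ 2)), pow_mul] at e2
    rw [Nat.succ_eq_add_one, pow_succ (-1 : ZMod (p ^ 2)), show 2 * (j + 1) = 2 * j + 1 + 1 by ring]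
    push_cast at e2
    simp only [neg_one_sq, one_pow] at e2
    linear_combination ((j + 1).centralBinom : ZMod (p ^ 2)) * e2
      + ((j + 1).centralBinom : ZMod (p ^ 2)) * (-1) ^ j * e1
      + ((j + 1).centralBinom : ZMod (p ^ 2)) * p * h4
  · have hne : 2 * (j + 1) ≠ p := fun e => h2
      ((Nat.prime_dvd_prime_iff_eq Nat.prime_two hp).mp ⟨_, e.symm⟩).symm
    have hz : p.choose (2 * (j + 1)) = 0 := Nat.choose_eq_zero_of_lt (by omega)
    have hd : p ∣ (j + 1).centralBinom := by
      rw [Nat.centralBinom]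
      exact hp.dvd_choose hk (by omega) h
    rw [Nat.succ_eq_add_one, hz, mul_assoc, natCast_mul_eq_zero (hp.dvd_choose_self (by omega) hk) hd]
    simp

theorem isUnit_ofNat_three {p : ℕ} (hp : p.Prime) (h3 : p ≠ 3) : IsUnit (3 : ZMod (p ^ 2)) := by
  exact_mod_cast isUnit_natCast_sq (k := 3) hp fun h =>
    h3 ((Nat.prime_dvd_prime_iff_eq hp Nat.prime_three).mp h)

theorem sum_range_succ_prime {R : Type*} [AddCommMonoid R] {p : ℕ} (hp : 0 < p) (f : ℕ → R) :
    ∑ k ∈ range (p + 1), f k = (∑ j ∈ range (p - 1), f (j + 1) + f 0) + f p := by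
  rw [sum_range_succ]
  conv_lhs => rw [show p = p - 1 + 1 by omega]
  rw [sum_range_succ', Nat.sub_add_cancel hp]

theorem sum_interior {p : ℕ} (hp : p.Prime) (h2 : p ≠ 2) (m : ℤ) :
    ∑ j ∈ range (p - 1), (-1) ^ (j + 1) * (p.choose (j + 1) : ZMod (p ^ 2))
        * (j + 1).centralBinom * m ^ (p - 1 - j)
      = -T p (2 - m) 1 - m ^ p + 2 := by
  have h := congrArg (Int.cast : ℤ → ZMod (p ^ 2)) (sum_choose_mul_centralBinom p m)
  rw [sum_range_succ_prime hp.pos, (hp.odd_of_ne_two h2).neg_one_pow] at h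
  push_cast at h
  rw [centralBinom_prime hp] at h
  simp only [pow_zero, Nat.choose_zero_right, Nat.centralBinom_zero, Nat.sub_zero,
    Nat.choose_self, Nat.sub_self, Nat.cast_one, mul_one, one_mul] at h
  have e : ∑ j ∈ range (p - 1), (-1) ^ (j + 1) * (p.choose (j + 1) : ZMod (p ^ 2))
        * (j + 1).centralBinom * m ^ (p - 1 - j)
      = ∑ j ∈ range (p - 1), (-1) ^ (j + 1) * (p.choose (j + 1) : ZMod (p ^ 2))
        * (j + 1).centralBinom * m ^ (p - (j + 1)) :=
    sum_congr rfl fun j _ => by rw [show p - 1 - j = p - (j + 1) by omega]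
  rw [e]
  linear_combination h

/-- Two expansions of `T_p(1, 1)` have interior sums related by a factor 2; comparing them gives `2
(T_p - 1) = 1 - T_p`, and 3 is invertible. -/
theorem T_prime {p : ℕ} (hp : p.Prime) (h2 : p ≠ 2) (h3 : p ≠ 3) :
    (T p 1 1 : ZMod (p ^ 2)) = 1 := by
  have h := sum_interior hp h2 1
  have hT := congrArg (Int.cast : ℤ → ZMod (p ^ 2)) (T_eq_sum (n := p) (N := p + 1) 1 1 (by omega))
  rw [sum_range_succ_prime hp.pos] at hT
  have hz : p.choose (2 * p) = 0 := Nat.choose_eq_zero_of_lt (by have := hp.pos; omega)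
  rw [hz] at hT
  push_cast at hT
  simp only [one_pow, mul_one, zero_mul, add_zero, Nat.choose_zero_right, Nat.cast_one,
    Nat.centralBinom_zero] at hT
  have e : ∑ j ∈ range (p - 1), (-1) ^ (j + 1) * (p.choose (j + 1) : ZMod (p ^ 2))
        * (j + 1).centralBinom
      = 2 * ∑ j ∈ range (p - 1), (p.choose (2 * (j + 1)) : ZMod (p ^ 2)) * (j + 1).centralBinom := by
    rw [mul_sum]
    refine sum_congr rfl fun j hj => ?_
    rw [two_mul_choose_mul_centralBinom hp h2 (Nat.succ_pos j)
      (by simp only [mem_range] at hj; omega)]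
  simp only [Int.cast_one, one_pow, mul_one, e] at h
  norm_num at h
  refine (isUnit_ofNat_three hp h3).mul_left_cancel ?_
  linear_combination 2 * hT + h

/-! ### The weighted Catalan sums modulo `p ^ 2` -/

theorem sum_catalan_prime {p h : ℕ} (hp : p.Prime) (hh : p = 2 * h + 1) {m : ZMod (p ^ 2)}
    {v : ℕ → ZMod (p ^ 2)} (h0 : v 0 = 1) (h1 : v 1 = 1)
    (hv : ∀ k, v (k + 2) = (m - 2) * v (k + 1) - v k) :
    ∑ k ∈ range p, (catalan k : ZMod (p ^ 2)) * m ^ (p - 1 - k)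
      = 2 * (m ^ h * (v h + v (h + 1))) - 2 - v p := by
  have e1 := sum_choose_mul_recurrence hv h 0
  rw [show 2 * h + 2 = p + 1 by omega, ← hh, sum_range_succ_prime hp.pos] at e1
  simp only [add_zero, Nat.choose_zero_right, Nat.choose_self, Nat.cast_one, one_mul, h0] at e1
  rw [sum_catalan_eq h0 h1 hv le_rfl]
  conv_lhs => rw [show range p = range (p - 1 + 1) by rw [Nat.sub_add_cancel hp.one_le]]
  rw [sum_range_succ, Nat.sub_add_cancel hp.one_le, show p + 1 + (p - 1) = 2 * p by have := hp.pos; omega,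
    Nat.choose_self]
  have e2 : ∀ j ∈ range (p - 1), ((2 * p).choose (p + 1 + j) : ZMod (p ^ 2)) * v (j + 1)
      = 2 * (p.choose (j + 1) * v (j + 1)) := by
    intro j hj
    have hj' : j + 1 < p := by simp only [mem_range] at hj; omega
    rw [← Nat.choose_symm (show p + 1 + j ≤ 2 * p by omega),
      choose_two_mul_prime hp (by omega) (by omega),
      show 2 * p - (p + 1 + j) = p - (j + 1) by omega, Nat.choose_symm hj'.le]
    ring
  rw [sum_congr rfl e2, ← mul_sum]
  push_cast
  linear_combination 2 * e1

theorem sum_wInt_mul_catalan {p h : ℕ} (hp : p.Prime) (hh : p = 2 * h + 1) (m : ℤ)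
    {v : ℕ → ZMod (p ^ 2)} (h0 : v 0 = 1) (h1 : v 1 = 1)
    (hv : ∀ k, v (k + 2) = ((m : ZMod (p ^ 2)) - 2) * v (k + 1) - v k) :
    2 * ((p : ZMod (p ^ 2)) + 1)
        * ∑ j ∈ range p, (-1) ^ j * (wInt p j : ZMod (p ^ 2)) * catalan j * m ^ (p - 1 - j)
      = 2 * (1 + 2 * (p : ZMod (p ^ 2)))
          * (2 * ((m : ZMod (p ^ 2)) ^ h * (v h + v (h + 1))) - v p + 2 * (p : ZMod (p ^ 2)) - 3)
        - (T p (2 - m) 1 : ZMod (p ^ 2)) - (m : ZMod (p ^ 2)) ^ p + 2 := by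
  have h2 : p ≠ 2 := by omega
  have hodd : Even (p - 1) := ⟨h, by omega⟩
  have eF := sum_catalan_prime hp hh h0 h1 hv
  have eI := sum_interior hp h2 m
  -- The index `j = p - 1` is split off: there `j + 1 = p` is not a unit, so `wInt_mul_catalan` does
  -- not apply.
  have hr : range p = range (p - 1 + 1) := by rw [Nat.sub_add_cancel hp.one_le]
  rw [hr, sum_range_succ, catalan_pred_prime hp h2] at eF
  rw [hr, sum_range_succ, catalan_pred_prime hp h2, wInt_prime_pred hp, hodd.neg_one_pow]
  simp only [Nat.sub_self, pow_zero, mul_one, one_mul] at eF ⊢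
  have e : 2 * ((p : ZMod (p ^ 2)) + 1)
        * ∑ j ∈ range (p - 1), (-1) ^ j * (wInt p j : ZMod (p ^ 2)) * catalan j * m ^ (p - 1 - j)
      = 2 * (1 + 2 * p) * ∑ j ∈ range (p - 1), (catalan j : ZMod (p ^ 2)) * m ^ (p - 1 - j)
        + ∑ j ∈ range (p - 1), (-1) ^ (j + 1) * (p.choose (j + 1) : ZMod (p ^ 2))
        * (j + 1).centralBinom * m ^ (p - 1 - j) := by
    rw [mul_sum, mul_sum, ← sum_add_distrib]
    refine sum_congr rfl fun j hj => ?_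
    have := wInt_mul_catalan hp (j := j) (by simp only [mem_range] at hj; omega)
    linear_combination (m : ZMod (p ^ 2)) ^ (p - 1 - j) * this
  rw [mul_add, e, eI]
  linear_combination 2 * (1 + 2 * (p : ZMod (p ^ 2))) * eF + (8 * p + 4) * natCast_mul_self_sq p

/-- The sequence with `v 0 = v 1 = 1` and `v (k + 2) = (m - 2) * v (k + 1) - v k`. -/
def lucasDiff (m : ℤ) : ℕ → ℤ
  | 0 => 1
  | 1 => 1
  | k + 2 => (m - 2) * lucasDiff m (k + 1) - lucasDiff m k

/-- The sequence is `1, 1, -2` repeated. -/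
theorem lucasDiff_one (q : ℕ) : lucasDiff 1 (3 * q) = 1 ∧ lucasDiff 1 (3 * q + 1) = 1 := by
  induction q with
  | zero => simp [lucasDiff]
  | succ q ih =>
    rw [show 3 * (q + 1) = 3 * q + 1 + 2 by ring, show 3 * q + 1 + 2 + 1 = 3 * q + 2 + 2 by ring]
    simp only [lucasDiff, ih]
    norm_num

/-- The sequence is `1, 1, 0, -1, -1, 0` repeated. -/
theorem lucasDiff_three (q : ℕ) :
    lucasDiff 3 (3 * q) = (-1) ^ q ∧ lucasDiff 3 (3 * q + 1) = (-1) ^ q := by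
  induction q with
  | zero => simp [lucasDiff]
  | succ q ih =>
    rw [show 3 * (q + 1) = 3 * q + 1 + 2 by ring, show 3 * q + 1 + 2 + 1 = 3 * q + 2 + 2 by ring]
    simp only [lucasDiff, ih, pow_succ]
    constructor <;> ring

/-! ### Supercongruences for the sums over `k < p` -/

theorem congMod_of_mul_eq {p m : ℕ} {x y : ℚ} (a b : ℤ) (hb : ¬ (p : ℤ) ∣ b)
    (h : (x - y) * b = (p : ℚ) ^ m * a) : CongMod p m x y := by
  have hb0 : (b : ℚ) ≠ 0 := by
    rintro h0
    exact hb (by rw [Int.cast_eq_zero.mp h0]; exact dvd_zero _)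
  refine ⟨a / b, fun hd => hb ?_, ?_⟩
  · exact (Int.natCast_dvd_natCast.mpr hd).trans (by
      rw [← Rat.divInt_eq_div]; exact Rat.den_dvd a b)
  · rw [← mul_div_assoc, ← h, mul_div_cancel_right₀ _ hb0]

theorem legendreSym_three_of_mod_eq_one {p : ℕ} (h : p % 3 = 1) : legendreSym 3 (p : ℤ) = 1 := by
  rw [legendreSym.mod, show ((p : ℤ) % (3 : ℕ)) = 1 by omega]
  decide

theorem legendreSym_three_of_mod_eq_two {p : ℕ} (h : p % 3 = 2) : legendreSym 3 (p : ℤ) = -1 := by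
  rw [legendreSym.mod, show ((p : ℤ) % (3 : ℕ)) = 2 by omega]
  decide

theorem six_mul_add {p h : ℕ} (hp : p.Prime) (h3 : p ≠ 3) (hh : p = 2 * h + 1) :
    ∃ q, (h = 3 * q ∧ p = 3 * (2 * q) + 1 ∧ legendreSym 3 (p : ℤ) = 1)
      ∨ (h = 3 * q + 2 ∧ p = 3 * (2 * q + 1) + 2 ∧ legendreSym 3 (p : ℤ) = -1) := by
  have h0 : p % 3 ≠ 0 := fun h0 =>
    h3 ((Nat.prime_dvd_prime_iff_eq Nat.prime_three hp).mp (Nat.dvd_of_mod_eq_zero h0)).symm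
  refine ⟨h / 3, ?_⟩
  rcases (show p % 3 = 1 ∨ p % 3 = 2 by omega) with h1 | h1
  · exact Or.inl ⟨by omega, by omega, legendreSym_three_of_mod_eq_one h1⟩
  · exact Or.inr ⟨by omega, by omega, legendreSym_three_of_mod_eq_two h1⟩

theorem lucasDiff_one_prime {p h : ℕ} (hp : p.Prime) (h3 : p ≠ 3) (hh : p = 2 * h + 1) :
    2 * (lucasDiff 1 h + lucasDiff 1 (h + 1)) = 3 * legendreSym 3 (p : ℤ) + 1
      ∧ 2 * lucasDiff 1 p = 3 * legendreSym 3 (p : ℤ) - 1 := by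
  obtain ⟨q, ⟨hq, hpq, he⟩ | ⟨hq, hpq, he⟩⟩ := six_mul_add hp h3 hh
  · rw [he, hq, hpq, (lucasDiff_one q).1, (lucasDiff_one q).2, (lucasDiff_one _).2]
    norm_num
  · rw [he, hq, hpq, show 3 * q + 2 + 1 = 3 * (q + 1) by ring, (lucasDiff_one (q + 1)).1]
    simp only [lucasDiff, lucasDiff_one]
    norm_num

theorem lucasDiff_three_prime {p h : ℕ} (hp : p.Prime) (h3 : p ≠ 3) (hh : p = 2 * h + 1) :
    2 * ((-1) ^ h * legendreSym 3 (p : ℤ)) * (lucasDiff 3 h + lucasDiff 3 (h + 1))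
        = 3 + legendreSym 3 (p : ℤ)
      ∧ 2 * lucasDiff 3 p = 1 + legendreSym 3 (p : ℤ) := by
  obtain ⟨q, ⟨hq, hpq, he⟩ | ⟨hq, hpq, he⟩⟩ := six_mul_add hp h3 hh
  · have h4 : ((-1 : ℤ) ^ q) ^ 3 * (-1) ^ q = 1 := by rw [← pow_succ, ← pow_mul, mul_comm, pow_mul]; simp
    rw [he, hq, hpq, (lucasDiff_three q).1, (lucasDiff_three q).2, (lucasDiff_three _).2, mul_comm 3 q,
      pow_mul (-1 : ℤ) q 3, pow_mul (-1 : ℤ) 2 q]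
    constructor
    · linear_combination 4 * h4
    · norm_num
  · have h4 : ((-1 : ℤ) ^ q) ^ 3 * (-1) ^ q = 1 := by rw [← pow_succ, ← pow_mul, mul_comm, pow_mul]; simp
    rw [he, hq, hpq, show 3 * q + 2 + 1 = 3 * (q + 1) by ring, (lucasDiff_three (q + 1)).1]
    simp only [lucasDiff, lucasDiff_three]
    rw [mul_comm 3 q, pow_add, pow_mul (-1 : ℤ) q 3]
    constructor
    · linear_combination 2 * h4
    · norm_num

theorem legendreSym_three_sq {p : ℕ} (hp : p.Prime) (h3 : p ≠ 3) :
    legendreSym 3 (p : ℤ) ^ 2 = 1 := by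
  refine legendreSym.sq_one 3 fun h => h3 ?_
  rw [Int.cast_natCast, ZMod.natCast_eq_zero_iff] at h
  exact ((Nat.prime_dvd_prime_iff_eq Nat.prime_three hp).mp h).symm

/-- With `s = (3/p)`, Euler's criterion gives `3 ^ h ≡ s` modulo `p`, so `(3 ^ h - s) ^ 2` vanishes
modulo `p ^ 2`; reciprocity rewrites `s`. -/
theorem three_pow_half {p h : ℕ} [hp : Fact p.Prime] (h3 : p ≠ 3) (hh : p = 2 * h + 1) :
    2 * (3 : ZMod (p ^ 2)) ^ h
      = ((-1) ^ h * legendreSym 3 (p : ℤ) : ℤ) * (1 + 3 ^ (p - 1)) := by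
  set s : ℤ := (-1) ^ h * legendreSym 3 (p : ℤ) with hs
  have hs2 : s ^ 2 = 1 := by
    rw [hs, mul_pow, legendreSym_three_sq hp.out h3, mul_one, ← pow_mul, mul_comm, pow_mul,
      neg_one_sq, one_pow]
  have hps : legendreSym p 3 = s := by
    have := legendreSym.quadratic_reciprocity' (p := p) (q := 3) (by omega) (by norm_num)
    rw [hs, this, show p / 2 * (3 / 2) = h by omega, ← mul_assoc, ← mul_pow]
    simp
  have hd : (p : ℤ) ∣ 3 ^ h - s := by
    rw [← ZMod.intCast_eq_intCast_iff_dvd_sub, ← hps, legendreSym.eq_pow, show p / 2 = h by omega]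
    push_cast
    rfl
  have hz : (((3 ^ h - s) ^ 2 : ℤ) : ZMod (p ^ 2)) = 0 := by
    rw [ZMod.intCast_zmod_eq_zero_iff_dvd]
    push_cast
    exact pow_dvd_pow_of_dvd hd 2
  have hs2' : (s : ZMod (p ^ 2)) ^ 2 = 1 := by exact_mod_cast congrArg (Int.cast : ℤ → ZMod (p ^ 2)) hs2
  rw [show p - 1 = h * 2 by omega, pow_mul]
  push_cast at hz
  linear_combination -(s : ZMod (p ^ 2)) * hz + ((s : ZMod (p ^ 2)) - 2 * 3 ^ h) * hs2'

theorem natCast_mul_three_pow_sub_one {p : ℕ} [hp : Fact p.Prime] (h3 : p ≠ 3) :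
    (p : ZMod (p ^ 2)) * (3 ^ (p - 1) - 1) = 0 ∧ ((3 : ZMod (p ^ 2)) ^ (p - 1) - 1) ^ 2 = 0 := by
  have hd : (p : ℤ) ∣ 3 ^ (p - 1) - 1 := by
    refine (Int.ModEq.pow_card_sub_one_eq_one hp.out ?_).symm.dvd
    exact_mod_cast (Nat.coprime_primes Nat.prime_three hp.out).mpr h3.symm
  obtain ⟨r, hr⟩ := hd
  have hr' : (3 : ZMod (p ^ 2)) ^ (p - 1) - 1 = p * r := by
    exact_mod_cast congrArg (Int.cast : ℤ → ZMod (p ^ 2)) hr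
  have hpp := natCast_mul_self_sq p
  rw [hr']
  constructor
  · linear_combination (r : ZMod (p ^ 2)) * hpp
  · linear_combination (r : ZMod (p ^ 2)) ^ 2 * hpp

theorem two_mul_sum_wInt_one {p : ℕ} (hp : p.Prime) (hp3 : 3 < p) :
    2 * ((∑ j ∈ range p, wInt p j * catalan j * (-1) ^ j : ℤ) : ZMod (p ^ 2))
      = 3 * (legendreSym 3 (p : ℤ) - 1) + p * (3 * legendreSym 3 (p : ℤ) + 1) := by
  obtain ⟨h, hh⟩ := hp.odd_of_ne_two (by omega)
  have h1 := sum_wInt_mul_catalan hp hh 1 (v := fun k => (lucasDiff 1 k : ZMod (p ^ 2)))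
    (by simp [lucasDiff]) (by simp [lucasDiff]) (fun k => by simp only [lucasDiff]; push_cast; ring)
  obtain ⟨e1, e2⟩ := lucasDiff_one_prime hp (by omega) hh
  have e1' := congrArg (Int.cast : ℤ → ZMod (p ^ 2)) e1
  have e2' := congrArg (Int.cast : ℤ → ZMod (p ^ 2)) e2
  have hT := T_prime hp (by omega) (by omega)
  have hpp := natCast_mul_self_sq p
  push_cast at e1' e2' ⊢
  have hsum : ∑ j ∈ range p, (wInt p j : ZMod (p ^ 2)) * catalan j * (-1) ^ j
      = ∑ j ∈ range p, (-1) ^ j * (wInt p j : ZMod (p ^ 2)) * catalan j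
        * ((1 : ℤ) : ZMod (p ^ 2)) ^ (p - 1 - j) :=
    sum_congr rfl fun j _ => by simp; ring
  rw [← hsum, show (2 - 1 : ℤ) = 1 by norm_num, hT] at h1
  simp only [Int.cast_one, one_pow, one_mul] at h1
  generalize (∑ j ∈ range p, (wInt p j : ZMod (p ^ 2)) * catalan j * (-1) ^ j) = Q at h1 ⊢
  generalize (legendreSym 3 (p : ℤ) : ZMod (p ^ 2)) = ε at *
  linear_combination (1 - (p : ZMod (p ^ 2))) * h1 + (1 - p) * (1 + 2 * p) * (2 * e1' - e2')
    + (2 * Q - 6 * ε + 10 - 8 * p) * hpp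

/-- The factor `3 ^ (p - 1)` is pulled out to cancel the denominator `(-3) ^ (p - 1)` of the
original sum; the one left inside yields the Fermat quotient. -/
theorem two_mul_sum_wInt_three {p : ℕ} (hp : p.Prime) (hp3 : 3 < p) :
    2 * ((∑ j ∈ range p, wInt p j * catalan j * (-3) ^ (p - 1 - j) : ℤ) : ZMod (p ^ 2))
      = 3 ^ (p - 1) * (legendreSym 3 (p : ℤ) - 2 + 3 ^ (p - 1) + p * (legendreSym 3 (p : ℤ) + 3)) := by
  have : Fact p.Prime := ⟨hp⟩
  obtain ⟨h, hh⟩ := hp.odd_of_ne_two (by omega)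
  have h1 := sum_wInt_mul_catalan hp hh 3 (v := fun k => (lucasDiff 3 k : ZMod (p ^ 2)))
    (by simp [lucasDiff]) (by simp [lucasDiff]) (fun k => by simp only [lucasDiff]; push_cast; ring)
  obtain ⟨e1, e2⟩ := lucasDiff_three_prime hp (by omega) hh
  have e1' := congrArg (Int.cast : ℤ → ZMod (p ^ 2)) e1
  have e2' := congrArg (Int.cast : ℤ → ZMod (p ^ 2)) e2
  have hT := T_prime hp (by omega) (by omega)
  have hpp := natCast_mul_self_sq p
  have hpow := three_pow_half (p := p) (by omega) hh
  obtain ⟨y1, y2⟩ := natCast_mul_three_pow_sub_one (p := p) (by omega)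
  have hT' : (T p (2 - 3) 1 : ZMod (p ^ 2)) = -1 := by
    rw [show (2 - 3 : ℤ) = -1 by norm_num, T_neg_left, (hp.odd_of_ne_two (by omega)).neg_one_pow]
    push_cast
    rw [hT]; ring
  have hsum : ∑ j ∈ range p, (wInt p j : ZMod (p ^ 2)) * catalan j * (-3) ^ (p - 1 - j)
      = ∑ j ∈ range p, (-1) ^ j * (wInt p j : ZMod (p ^ 2)) * catalan j
        * ((3 : ℤ) : ZMod (p ^ 2)) ^ (p - 1 - j) := by
    refine sum_congr rfl fun j hj => ?_
    have e : (-1 : ZMod (p ^ 2)) ^ (p - 1 - j) = (-1) ^ j := by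
      have : p - 1 - j + j = 2 * h := by simp only [mem_range] at hj; omega
      have h4 : (-1 : ZMod (p ^ 2)) ^ (p - 1 - j) * (-1) ^ j = 1 := by
        rw [← pow_add, this, pow_mul]; simp
      have h5 : ((-1 : ZMod (p ^ 2)) ^ j) * (-1) ^ j = 1 := by rw [← mul_pow]; simp
      linear_combination (-1) ^ j * h4 - (-1) ^ (p - 1 - j) * h5
    rw [neg_pow, e]
    push_cast
    ring
  have hp1 : (3 : ZMod (p ^ 2)) ^ p = 3 ^ (p - 1) * 3 := by
    rw [← pow_succ, Nat.sub_add_cancel hp.one_le]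
  rw [← hsum, hT'] at h1
  push_cast at h1 e1' e2' hpow ⊢
  rw [hp1] at h1
  generalize (∑ j ∈ range p, (wInt p j : ZMod (p ^ 2)) * catalan j * (-3) ^ (p - 1 - j)) = Q at h1 ⊢
  generalize (legendreSym 3 (p : ℤ) : ZMod (p ^ 2)) = ε at *
  generalize (3 : ZMod (p ^ 2)) ^ (p - 1) = y at *
  have hV : 4 * ((3 : ZMod (p ^ 2)) ^ h * ((lucasDiff 3 h : ZMod (p ^ 2)) + lucasDiff 3 (h + 1)))
      = (1 + y) * (3 + ε) := by
    linear_combination 2 * ((lucasDiff 3 h : ZMod (p ^ 2)) + lucasDiff 3 (h + 1)) * hpow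
      + (1 + y) * e1'
  have h2 : 2 * ((p : ZMod (p ^ 2)) + 1) * Q
      = (1 + 2 * p) * ((1 + y) * (3 + ε) - (1 + ε) + 4 * p - 6) + 3 - 3 * y := by
    linear_combination h1 + (1 + 2 * (p : ZMod (p ^ 2))) * (hV - e2')
  linear_combination (1 - (p : ZMod (p ^ 2))) * h2
    + (2 * Q + 4 - 2 * ((1 + y) * (3 + ε) - (1 + ε) + 4 * p - 6)) * hpp + 3 * y1 - y2

theorem sum_one_one_congMod {p : ℕ} (hp : p.Prime) (hp3 : 3 < p) :
    CongMod p 3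
      (∑ k ∈ range p, (T k 1 1 : ℚ) * (M k 1 1 : ℚ) / (-3 : ℚ) ^ k)
      ((p : ℚ) / 2 * ((legendreSym 3 (p : ℤ) : ℚ) - 1)
        + (p : ℚ) ^ 2 / 2 * (fermatQuotient p 3 + (legendreSym 3 (p : ℤ) : ℚ) + 3)) := by
  have h := two_mul_sum_wInt_three hp hp3
  set Q : ℤ := ∑ j ∈ range p, wInt p j * catalan j * (-3) ^ (p - 1 - j) with hQ
  have hz : ((2 * Q - 3 ^ (p - 1) * (legendreSym 3 (p : ℤ) - 2 + 3 ^ (p - 1)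
      + p * (legendreSym 3 (p : ℤ) + 3)) : ℤ) : ZMod (p ^ 2)) = 0 := by
    push_cast
    exact sub_eq_zero.mpr h
  rw [ZMod.intCast_zmod_eq_zero_iff_dvd] at hz
  obtain ⟨a, ha⟩ := hz
  have ha' := congrArg (Int.cast : ℤ → ℚ) ha
  have hev : Even (p - 1) := hp.even_sub_one (by omega)
  have hp0 : (p : ℚ) ≠ 0 := by exact_mod_cast hp.ne_zero
  refine congMod_of_mul_eq a (2 * 3 ^ (p - 1)) (fun hd => ?_) ?_
  · have hd' : p ∣ 2 * 3 ^ (p - 1) := by exact_mod_cast hd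
    rcases hp.dvd_mul.mp hd' with h2 | h2
    · exact absurd (Nat.le_of_dvd (by norm_num) h2) (by omega)
    · exact absurd (Nat.le_of_dvd (by norm_num) (hp.dvd_of_dvd_pow h2)) (by omega)
  · have hS := sum_T_mul_M_div_one_one hp.pos
    rw [hev.neg_pow] at hS
    have hQ' : (Q : ℚ) = ∑ j ∈ range p, (wInt p j : ℚ) * catalan j * (-3) ^ (p - 1 - j) := by
      rw [hQ]; push_cast; rfl
    rw [hS, ← hQ', fermatQuotient]
    push_cast at ha' ⊢
    have hy : (3 : ℚ) ^ (p - 1) ≠ 0 := by positivity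
    generalize (3 : ℚ) ^ (p - 1) = y at *
    have e1 : (p : ℚ) * Q / y * y = p * Q := div_mul_cancel₀ _ hy
    have e2 : (p : ℚ) * ((y - 1) / p) = y - 1 := mul_div_cancel₀ _ hp0
    linear_combination (p : ℚ) * ha' + 2 * e1 - p * y * e2

theorem sum_three_three_congMod {p : ℕ} (hp : p.Prime) (hp3 : 3 < p) :
    CongMod p 3
      (∑ k ∈ range p, (T k 3 3 : ℚ) * (M k 3 3 : ℚ) / (-3 : ℚ) ^ k)
      (3 * (p : ℚ) / 2 * ((legendreSym 3 (p : ℤ) : ℚ) - 1)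
        + (p : ℚ) ^ 2 / 2 * (3 * (legendreSym 3 (p : ℤ) : ℚ) + 1)) := by
  have h := two_mul_sum_wInt_one hp hp3
  set Q : ℤ := ∑ j ∈ range p, wInt p j * catalan j * (-1) ^ j with hQ
  have hz : ((2 * Q - (3 * (legendreSym 3 (p : ℤ) - 1)
      + p * (3 * legendreSym 3 (p : ℤ) + 1)) : ℤ) : ZMod (p ^ 2)) = 0 := by
    push_cast
    exact sub_eq_zero.mpr h
  rw [ZMod.intCast_zmod_eq_zero_iff_dvd] at hz
  obtain ⟨a, ha⟩ := hz
  have ha' := congrArg (Int.cast : ℤ → ℚ) ha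
  refine congMod_of_mul_eq a 2 (fun hd => ?_) ?_
  · have hd' : p ∣ 2 := by exact_mod_cast hd
    exact absurd (Nat.le_of_dvd (by norm_num) hd') (by omega)
  · have hQ' : (Q : ℚ) = ∑ j ∈ range p, (wInt p j : ℚ) * catalan j * (-1) ^ j := by
      rw [hQ]; push_cast; rfl
    rw [sum_T_mul_M_three_three hp.pos, ← hQ']
    push_cast at ha' ⊢
    linear_combination (p : ℚ) * ha'

/-! ### Sums weighted by `k` modulo `p` -/

theorem sum_eval_eq_neg_coeff {p : ℕ} [hp : Fact p.Prime] (P : Polynomial (ZMod p))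
    (hdeg : P.natDegree < 2 * (p - 1)) :
    ∑ x : ZMod p, P.eval x = -P.coeff (p - 1) := by
  have hpow : ∀ i, i < 2 * (p - 1) →
      ∑ x : ZMod p, x ^ i = if i = p - 1 then -1 else 0 := by
    intro i hi
    rcases lt_trichotomy i (p - 1) with h | h | h
    · rw [if_neg h.ne]
      exact FiniteField.sum_pow_lt_card_sub_one (ZMod p) i (by rwa [ZMod.card])
    · subst h
      rw [if_pos rfl, ← Finset.sum_erase_add _ _ (mem_univ (0 : ZMod p)),
        sum_congr rfl fun x hx => ZMod.pow_card_sub_one_eq_one (ne_of_mem_erase hx)]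
      have := hp.out.two_le
      simp [card_erase_of_mem, ZMod.card, Nat.cast_sub hp.out.one_le, zero_pow (show p - 1 ≠ 0 by omega)]
    · rw [if_neg h.ne']
      -- This holds at `x = 0` too, since the reduced exponent is still positive.
      have e : ∀ x : ZMod p, x ^ i = x ^ (i - (p - 1)) := by
        intro x
        have h1 : i = p + (i - p) := by omega
        have h2 : i - (p - 1) = 1 + (i - p) := by omega
        rw [h2]
        nth_rw 1 [h1]
        rw [pow_add, pow_add, ZMod.pow_card, pow_one]
      rw [sum_congr rfl fun x _ => e x]
      exact FiniteField.sum_pow_lt_card_sub_one (ZMod p) _ (by rw [ZMod.card]; omega)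
  simp only [Polynomial.eval_eq_sum_range' hdeg]
  rw [sum_comm]
  simp only [← mul_sum]
  rw [sum_congr rfl fun i hi => by rw [hpow i (mem_range.mp hi)]]
  have := hp.out.two_le
  simp
  omega

theorem sum_range_natCast {p : ℕ} [hp : Fact p.Prime] (f : ZMod p → ZMod p) :
    ∑ n ∈ range p, f n = ∑ x : ZMod p, f x := by
  refine sum_nbij' (fun n => (n : ZMod p)) (fun x => x.val) ?_ ?_ ?_ ?_ ?_
  · simp
  · intro x _; simp [ZMod.val_lt]
  · intro n hn; simp only [mem_range] at hn; exact ZMod.val_cast_of_lt hn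
  · intro x _; simp
  · simp

/-- The monic polynomial whose value at `n` is `(j + 1)! * j! * n.choose (j + 1) *
(n + j + 1).choose j`. -/
noncomputable def choosePoly (R : Type*) [CommRing R] (j : ℕ) : Polynomial R :=
  (∏ i ∈ range (j + 1), (Polynomial.X - Polynomial.C (i : R)))
    * ∏ i ∈ range j, (Polynomial.X - Polynomial.C (-(i + 2 : R)))

theorem choosePoly_eval (R : Type*) [CommRing R] (j n : ℕ) :
    (choosePoly R j).eval (n : R)
      = ((j + 1).factorial * n.choose (j + 1) : ℕ) * (j.factorial * (n + j + 1).choose j : ℕ) := by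
  rw [choosePoly, Polynomial.eval_mul, Polynomial.eval_prod, Polynomial.eval_prod,
    ← Nat.descFactorial_eq_factorial_mul_choose, ← Nat.descFactorial_eq_factorial_mul_choose]
  congr 1
  · have : ∀ k, ∏ i ∈ range k, ((n : R) - i) = (n.descFactorial k : R) := by
      intro k
      induction k with
      | zero => simp
      | succ k ih =>
        rw [prod_range_succ, ih, Nat.descFactorial_succ]
        by_cases h : k ≤ n
        · push_cast [Nat.cast_sub h]; ring
        · simp [Nat.descFactorial_of_lt (not_le.mp h)]
    simpa using this (j + 1)
  · have : ∀ k, ∏ i ∈ range k, ((n : R) + (i + 2)) = ((n + k + 1).descFactorial k : R) := by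
      intro k
      induction k with
      | zero => simp
      | succ k ih =>
        rw [prod_range_succ, ih, show n + (k + 1) + 1 = n + k + 1 + 1 by ring,
          Nat.succ_descFactorial_succ]
        push_cast; ring
    rw [← this j]
    exact prod_congr rfl fun i _ => by
      simp only [Polynomial.eval_sub, Polynomial.eval_X, Polynomial.eval_C]
      ring

theorem choosePoly_natDegree (R : Type*) [CommRing R] [Nontrivial R] (j : ℕ) :
    (choosePoly R j).natDegree = 2 * j + 1 := by
  rw [choosePoly, Polynomial.Monic.natDegree_mul, Polynomial.natDegree_prod_of_monic,
    Polynomial.natDegree_prod_of_monic]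
  · simp only [Polynomial.natDegree_X_sub_C, sum_const, card_range, smul_eq_mul]
    ring
  all_goals first
    | exact fun _ _ => Polynomial.monic_X_sub_C _
    | exact Polynomial.monic_prod_of_monic _ _ fun _ _ => Polynomial.monic_X_sub_C _

/-- Minus the sum of the roots: `-(0 + ... + j) + (2 + ... + (j + 1)) = j`. -/
theorem choosePoly_coeff (R : Type*) [CommRing R] [Nontrivial R] (j : ℕ) :
    (choosePoly R j).coeff (2 * j) = j := by
  have h : (choosePoly R j).nextCoeff = j := by
    rw [choosePoly, Polynomial.Monic.nextCoeff_mul, Polynomial.Monic.nextCoeff_prod,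
      Polynomial.Monic.nextCoeff_prod]
    · simp only [Polynomial.nextCoeff_X_sub_C]
      induction j with
      | zero => simp
      | succ j ih =>
        rw [sum_range_succ _ (j + 1), sum_range_succ (fun i => - -((i : R) + 2)) j]
        push_cast
        linear_combination ih
    all_goals first
      | exact fun _ _ => Polynomial.monic_X_sub_C _
      | exact Polynomial.monic_prod_of_monic _ _ fun _ _ => Polynomial.monic_X_sub_C _
  rw [← h, Polynomial.nextCoeff, choosePoly_natDegree]
  simp

/-- A denominator-free form of the closed formula, which can be cast into `ZMod p`. -/
theorem sum_T_mul_M_int {b c d : ℤ} (hd : d = b ^ 2 - 4 * c) (hd0 : d ≠ 0) (hc : c ≠ 0) (n : ℕ) :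
    ∑ k ∈ range n, T k b c * M k b c * d ^ (n - 1 - k)
      = ∑ j ∈ range n, (partialCoeff n j : ℤ) * c ^ j * d ^ (n - 1 - j) := by
  have hd0' : (d : ℚ) ≠ 0 := by exact_mod_cast hd0
  have h := sum_T_mul_M (b := b) (c := c) (d := d) (by exact_mod_cast hd) hd0' hc n
  have hpow : ∀ j ∈ range n, (d : ℚ) ^ (n - 1 - j) = d ^ (n - 1) / d ^ j := fun j hj => by
    have : j ≤ n - 1 := by simp only [mem_range] at hj; omega
    rw [pow_sub₀ _ hd0' this, div_eq_mul_inv]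
  have h1 : ∑ k ∈ range n, (T k b c : ℚ) * M k b c * d ^ (n - 1 - k)
      = d ^ (n - 1) * ∑ k ∈ range n, (T k b c : ℚ) * M k b c / d ^ k := by
    rw [mul_sum]
    exact sum_congr rfl fun k hk => by rw [hpow k hk]; ring
  have h2 : ∑ j ∈ range n, (partialCoeff n j : ℚ) * c ^ j * d ^ (n - 1 - j)
      = d ^ (n - 1) * ∑ j ∈ range n, (partialCoeff n j : ℚ) * (c / d) ^ j := by
    rw [mul_sum]
    exact sum_congr rfl fun k hk => by rw [hpow k hk, div_pow]; ring
  rw [h, ← h2] at h1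
  exact_mod_cast h1

theorem sum_T_mul_M_field {K : Type*} [Field K] {b c d : ℤ} (hd : d = b ^ 2 - 4 * c)
    (hd0 : (d : K) ≠ 0) (hc : c ≠ 0) (n : ℕ) :
    ∑ k ∈ range n, (T k b c : K) * M k b c / (d : K) ^ k
      = ∑ j ∈ range n, (partialCoeff n j : K) * ((c : K) / d) ^ j := by
  have h := congrArg (Int.cast : ℤ → K)
    (sum_T_mul_M_int hd (by rintro rfl; simp at hd0) hc n)
  push_cast at h
  have hpow : ∀ j ∈ range n, (d : K) ^ (n - 1 - j) = d ^ (n - 1) / d ^ j := fun j hj => by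
    have : j ≤ n - 1 := by simp only [mem_range] at hj; omega
    rw [pow_sub₀ _ hd0 this, div_eq_mul_inv]
  refine mul_left_cancel₀ (pow_ne_zero (n - 1) hd0) ?_
  rw [mul_sum, mul_sum]
  convert h using 1
  · exact sum_congr rfl fun k hk => by rw [hpow k hk]; ring
  · exact sum_congr rfl fun k hk => by rw [hpow k hk, div_pow]; ring

theorem sum_partial_sums {R : Type*} [CommRing R] (a : ℕ → R) (N : ℕ) :
    ∑ n ∈ range N, ∑ k ∈ range n, a k = ∑ k ∈ range N, ((N : R) - 1 - k) * a k := by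
  induction N with
  | zero => simp
  | succ N ih =>
    rw [sum_range_succ, ih, sum_range_succ _ N, ← sum_add_distrib]
    push_cast
    rw [show ((N : R) + 1 - 1 - N) * a N = 0 by ring, add_zero]
    exact sum_congr rfl fun k _ => by ring

theorem choose_pred_prime {p k : ℕ} (hp : p.Prime) (hk : k < p) :
    ((p - 1).choose k : ZMod p) = (-1) ^ k := by
  induction k with
  | zero => simp
  | succ k ih =>
    have h1 := ih (by omega)
    have h2 : p.choose (k + 1) = (p - 1).choose k + (p - 1).choose (k + 1) := by
      conv_lhs => rw [show p = (p - 1) + 1 by omega]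
      exact Nat.choose_succ_succ' _ _
    have h3 := (ZMod.natCast_eq_zero_iff _ p).mpr (hp.dvd_choose_self (Nat.succ_ne_zero k) hk)
    rw [Nat.succ_eq_add_one, h2] at h3
    push_cast at h3
    rw [pow_succ]
    linear_combination h3 - h1

theorem catalan_eq_zero_of_lt {p h j : ℕ} (hp : p.Prime) (hh : p = 2 * h + 1) (hj : h < j)
    (hjp : j + 1 < p) : (catalan j : ZMod p) = 0 := by
  rw [ZMod.natCast_eq_zero_iff]
  have h1 := succ_mul_catalan_eq_centralBinom j
  have h2 : p ∣ (j + 1) * catalan j := by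
    rw [h1, Nat.centralBinom]
    exact hp.dvd_choose (by omega) (by omega) (by omega)
  exact (hp.dvd_mul.mp h2).resolve_left (Nat.not_dvd_of_pos_of_lt (Nat.succ_pos j) hjp)

/-- For `j < h` the degree `2j + 1` is below `p - 1`; for `j > h` the Catalan number is divisible by
`p`. At `j = h` the subleading coefficient is needed, and Wilson's theorem evaluates the factorials.
-/
theorem sum_partialCoeff {p h j : ℕ} [hp : Fact p.Prime] (hh : p = 2 * h + 1) (hj : j + 1 < p) :
    ∑ n ∈ range p, (partialCoeff n j : ZMod p) = if j = h then -2 else 0 := by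
  have hfac : ∀ i, i < p → (i.factorial : ZMod p) ≠ 0 := fun i hi h0 => by
    rw [ZMod.natCast_eq_zero_iff, hp.out.dvd_factorial] at h0
    omega
  have hS : ((j + 1).factorial : ZMod p) * j.factorial * ∑ n ∈ range p, (partialCoeff n j : ZMod p)
      = catalan j * -(choosePoly (ZMod p) j).coeff (p - 1) := by
    rw [← sum_eval_eq_neg_coeff _ (by rw [choosePoly_natDegree]; omega),
      ← sum_range_natCast fun x => (choosePoly (ZMod p) j).eval x, mul_sum, mul_sum]
    refine sum_congr rfl fun n _ => ?_
    rw [choosePoly_eval, partialCoeff]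
    push_cast
    ring
  have hne : ((j + 1).factorial : ZMod p) * j.factorial ≠ 0 :=
    mul_ne_zero (hfac _ hj) (hfac _ (by omega))
  refine mul_left_cancel₀ hne ?_
  rw [hS]
  rcases lt_trichotomy j h with hlt | rfl | hgt
  · rw [if_neg hlt.ne, Polynomial.coeff_eq_zero_of_natDegree_lt
      (by rw [choosePoly_natDegree]; omega)]
    ring
  · rw [if_pos rfl, show p - 1 = 2 * j by omega, choosePoly_coeff]
    have hj1 : (j : ZMod p) + 1 ≠ 0 := by
      have := hfac (j + 1) hj
      rw [Nat.factorial_succ] at this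
      push_cast at this
      exact left_ne_zero_of_mul this
    have h2j : 2 * (j : ZMod p) + 1 = 0 := by
      have := congrArg (Nat.cast : ℕ → ZMod p) hh
      rw [ZMod.natCast_self] at this
      exact_mod_cast this.symm
    have hc : ((j : ZMod p) + 1) * catalan j = (-1) ^ j := by
      have h1 := congrArg (Nat.cast : ℕ → ZMod p) (succ_mul_catalan_eq_centralBinom j)
      have h2 := choose_pred_prime hp.out (show j < p by omega)
      rw [show p - 1 = 2 * j by omega] at h2
      rw [← h2]
      exact_mod_cast h1
    have hw : (-1 : ZMod p) ^ j * (j.factorial * j.factorial) = -1 := by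
      have h1 := Nat.choose_mul_factorial_mul_factorial (show j ≤ 2 * j by omega)
      have h2 := ZMod.wilsons_lemma p
      rw [show p - 1 = 2 * j by omega, ← h1, show 2 * j - j = j by omega] at h2
      have h3 := choose_pred_prime hp.out (show j < p by omega)
      rw [show p - 1 = 2 * j by omega] at h3
      push_cast at h2
      rw [← h3]
      linear_combination h2
    have h4 : ((-1 : ZMod p) ^ j) * (-1) ^ j = 1 := by rw [← mul_pow]; simp
    refine mul_left_cancel₀ hj1 ?_
    rw [Nat.factorial_succ]
    push_cast
    generalize (-1 : ZMod p) ^ j = e at *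
    generalize (j.factorial : ZMod p) = f at *
    have hf : f * f = -e := by linear_combination e * hw - f * f * h4
    have h2ne : (2 : ZMod p) ≠ 0 := by
      intro h0
      have h0' : ((2 : ℕ) : ZMod p) = 0 := by exact_mod_cast h0
      rw [ZMod.natCast_eq_zero_iff] at h0'
      have := Nat.le_of_dvd (by norm_num) h0'
      have := hp.out.two_le
      omega
    refine mul_left_cancel₀ h2ne ?_
    linear_combination (-2 * (j : ZMod p)) * hc + 4 * ((j : ZMod p) + 1) ^ 2 * hf
      + (-2 * e - 2 * e * (j + 1)) * h2j
  · rw [if_neg hgt.ne', catalan_eq_zero_of_lt hp.out hh hgt hj]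
    ring

theorem sum_mul_T_mul_M {p h : ℕ} [hp : Fact p.Prime] (hh : p = 2 * h + 1) {b c d : ℤ}
    (hd : d = b ^ 2 - 4 * c) (hd0 : (d : ZMod p) ≠ 0) (hc : c ≠ 0) :
    ∑ k ∈ range p, (k : ZMod p) * T k b c * M k b c / (d : ZMod p) ^ k
      = 2 * ((c : ZMod p) / d) ^ h := by
  have hR := sum_T_mul_M_field hd hd0 hc
  have hA := sum_partial_sums (fun k => (T k b c : ZMod p) * M k b c / (d : ZMod p) ^ k) p
  have hp0 : ∑ k ∈ range p, (T k b c : ZMod p) * M k b c / (d : ZMod p) ^ k = 0 := by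
    rw [hR]
    refine sum_eq_zero fun j _ => ?_
    have h1 := congrArg (Int.cast : ℤ → ZMod p) (mul_wInt hp.out.pos j)
    push_cast at h1
    rw [ZMod.natCast_self, zero_mul] at h1
    rw [partialCoeff]
    push_cast
    rw [← h1]
    ring
  have hinner : ∑ n ∈ range p, ∑ k ∈ range n, (T k b c : ZMod p) * M k b c / (d : ZMod p) ^ k
      = -2 * ((c : ZMod p) / d) ^ h := by
    -- `partialCoeff n j` vanishes for `n ≤ j`, so one range serves every `n < p`; stopping at `p -
    -- 1` keeps `j + 1 < p`.
    have e : ∀ n ∈ range p, ∑ k ∈ range n, (T k b c : ZMod p) * M k b c / (d : ZMod p) ^ k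
        = ∑ j ∈ range (p - 1), (partialCoeff n j : ZMod p) * ((c : ZMod p) / d) ^ j := by
      intro n hn
      rw [hR]
      refine sum_subset (fun i hi => ?_) fun j _ hj => ?_
      · simp only [mem_range] at *; omega
      · have : n < j + 1 := by simp only [mem_range] at hj; omega
        simp [partialCoeff, Nat.choose_eq_zero_of_lt this]
    rw [sum_congr rfl e, sum_comm]
    have e2 : ∀ j ∈ range (p - 1), ∑ n ∈ range p,
        (partialCoeff n j : ZMod p) * ((c : ZMod p) / d) ^ j
        = if j = h then -2 * ((c : ZMod p) / d) ^ j else 0 := by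
      intro j hj
      rw [← sum_mul, sum_partialCoeff hh (by simp only [mem_range] at hj; omega)]
      split_ifs <;> simp
    have := hp.out.two_le
    rw [sum_congr rfl e2, sum_ite_eq', if_pos (by simp only [mem_range]; omega)]
  rw [hinner] at hA
  have e3 : ∑ k ∈ range p, ((p : ZMod p) - 1 - k) * ((T k b c : ZMod p) * M k b c / (d : ZMod p) ^ k)
      = -(∑ k ∈ range p, (T k b c : ZMod p) * M k b c / (d : ZMod p) ^ k)
        - ∑ k ∈ range p, (k : ZMod p) * T k b c * M k b c / (d : ZMod p) ^ k := by
    rw [← sum_neg_distrib, ← sum_sub_distrib]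
    refine sum_congr rfl fun k _ => ?_
    rw [ZMod.natCast_self]
    ring
  rw [e3, hp0] at hA
  linear_combination hA

theorem congMod_one_of_sum_eq {p : ℕ} [hp : Fact p.Prime] (f : ℕ → ℤ) {d y : ℤ}
    (hd : (d : ZMod p) ≠ 0)
    (h : ∑ k ∈ range p, (f k : ZMod p) / (d : ZMod p) ^ k = y) :
    CongMod p 1 (∑ k ∈ range p, (f k : ℚ) / (d : ℚ) ^ k) y := by
  have hd0 : (d : ℚ) ≠ 0 := by
    intro h0
    rw [Int.cast_eq_zero.mp h0] at hd
    simp at hd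
  have key : ∀ {K : Type} [Field K], (d : K) ≠ 0 →
      (∑ k ∈ range p, (f k : K) / (d : K) ^ k) * d ^ (p - 1)
        = ((∑ k ∈ range p, f k * d ^ (p - 1 - k) : ℤ) : K) := by
    intro K _ hK
    push_cast
    rw [sum_mul]
    refine sum_congr rfl fun k hk => ?_
    rw [pow_sub₀ _ hK (show k ≤ p - 1 by simp only [mem_range] at hk; omega)]
    ring
  have hz : ((∑ k ∈ range p, f k * d ^ (p - 1 - k) - y * d ^ (p - 1) : ℤ) : ZMod p) = 0 := by
    rw [Int.cast_sub, ← key hd, h]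
    push_cast
    ring
  rw [ZMod.intCast_zmod_eq_zero_iff_dvd] at hz
  obtain ⟨a, ha⟩ := hz
  refine congMod_of_mul_eq a (d ^ (p - 1)) (fun hdvd => ?_) ?_
  · rw [← ZMod.intCast_zmod_eq_zero_iff_dvd] at hdvd
    push_cast at hdvd
    exact pow_ne_zero _ hd hdvd
  · have ha' := congrArg (Int.cast : ℤ → ℚ) ha
    rw [Int.cast_sub, ← key hd0] at ha'
    push_cast at ha' ⊢
    linear_combination ha'

theorem neg_three_ne_zero {p : ℕ} [hp : Fact p.Prime] (hp3 : 3 < p) : ((-3 : ℤ) : ZMod p) ≠ 0 := by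
  rw [Ne, ZMod.intCast_zmod_eq_zero_iff_dvd, dvd_neg]
  intro h
  have := Int.le_of_dvd (by norm_num) h
  omega

theorem sum_mul_one_one_congMod {p : ℕ} [hp : Fact p.Prime] (hp3 : 3 < p) :
    CongMod p 1
      (∑ k ∈ range p, (k : ℚ) * (T k 1 1 : ℚ) * (M k 1 1 : ℚ) / (-3 : ℚ) ^ k)
      (2 * (legendreSym 3 (p : ℤ) : ℚ)) := by
  obtain ⟨h, hh⟩ := hp.out.odd_of_ne_two (by omega)
  have hd0 := neg_three_ne_zero hp3
  have hs := sum_mul_T_mul_M hh (b := 1) (c := 1) (d := -3) (by norm_num) hd0 (by norm_num)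
  -- Reciprocity gives `(p/3) = (-1)^h (3/p)`, and Euler's criterion turns `(3/p)` into `3 ^ h`.
  have hε : (legendreSym 3 (p : ℤ) : ZMod p) = ((-3 : ℤ) : ZMod p) ^ h := by
    have h1 := legendreSym.quadratic_reciprocity' (p := p) (q := 3) (by omega) (by norm_num)
    have h2 := legendreSym.eq_pow p 3
    rw [show p / 2 = h by omega] at h2
    rw [show p / 2 * (3 / 2) = h by omega] at h1
    have h1' := congrArg (Int.cast : ℤ → ZMod p) h1
    push_cast at h1' h2 ⊢
    rw [h1', h2, ← mul_pow]
    norm_num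
  have hε2 : (legendreSym 3 (p : ℤ) : ZMod p) ^ 2 = 1 := by
    exact_mod_cast congrArg (Int.cast : ℤ → ZMod p) (legendreSym_three_sq hp.out (by omega))
  have hx : (((1 : ℤ) : ZMod p) / ((-3 : ℤ) : ZMod p)) ^ h = legendreSym 3 (p : ℤ) := by
    rw [div_pow, ← hε, Int.cast_one, one_pow, div_eq_iff (by rw [hε]; exact pow_ne_zero _ hd0),
      ← sq, hε2]
  rw [hx] at hs
  have := congMod_one_of_sum_eq (p := p) (fun k => k * T k 1 1 * M k 1 1) (d := -3)
    (y := 2 * legendreSym 3 (p : ℤ)) hd0 (by push_cast at hs ⊢; exact hs)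
  push_cast at this
  exact this

theorem sum_mul_three_three_congMod {p : ℕ} [hp : Fact p.Prime] (hp3 : 3 < p) :
    CongMod p 1
      (∑ k ∈ range p, (k : ℚ) * (T k 3 3 : ℚ) * (M k 3 3 : ℚ) / (-3 : ℚ) ^ k)
      (2 * (legendreSym p (-1) : ℚ)) := by
  obtain ⟨h, hh⟩ := hp.out.odd_of_ne_two (by omega)
  have hd0 := neg_three_ne_zero hp3
  have hs := sum_mul_T_mul_M hh (b := 3) (c := 3) (d := -3) (by norm_num) hd0 (by norm_num)
  have hx : (((3 : ℤ) : ZMod p) / ((-3 : ℤ) : ZMod p)) ^ h = legendreSym p (-1) := by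
    rw [legendreSym.eq_pow, show p / 2 = h by omega]
    congr 1
    rw [div_eq_iff hd0]
    push_cast
    ring
  rw [hx] at hs
  have := congMod_one_of_sum_eq (p := p) (fun k => k * T k 3 3 * M k 3 3) (d := -3)
    (y := 2 * legendreSym p (-1)) hd0 (by push_cast at hs ⊢; exact hs)
  push_cast at this
  exact this

end SunTM

theorem corollary3p1 :
    (∀ n : ℕ, 0 < n →
      ((1 / (n : ℚ)) * ∑ k ∈ Finset.range n,
            (SunTM.T k 1 1 : ℚ) * (SunTM.M k 1 1 : ℚ) * (-3 : ℚ) ^ (n - 1 - k)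
          = ∑ k ∈ Finset.Icc 1 n, SunTM.w n k * (catalan (k - 1) : ℚ) * (-3 : ℚ) ^ (n - k)
        ∧ ∃ z : ℤ, (1 / (n : ℚ)) * ∑ k ∈ Finset.range n,
            (SunTM.T k 1 1 : ℚ) * (SunTM.M k 1 1 : ℚ) * (-3 : ℚ) ^ (n - 1 - k) = (z : ℚ))
      ∧ ((1 / (n : ℚ)) * ∑ k ∈ Finset.range n,
            (SunTM.T k 3 3 : ℚ) * (SunTM.M k 3 3 : ℚ) / (-3 : ℚ) ^ k
          = ∑ k ∈ Finset.Icc 1 n, (-1 : ℚ) ^ (k - 1) * SunTM.w n k * (catalan (k - 1) : ℚ)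
        ∧ ∃ z : ℤ, (1 / (n : ℚ)) * ∑ k ∈ Finset.range n,
            (SunTM.T k 3 3 : ℚ) * (SunTM.M k 3 3 : ℚ) / (-3 : ℚ) ^ k = (z : ℚ)))
    ∧ (∀ (p : ℕ) [Fact p.Prime], 3 < p →
      SunTM.CongMod p 3
          (∑ k ∈ Finset.range p, (SunTM.T k 1 1 : ℚ) * (SunTM.M k 1 1 : ℚ) / (-3 : ℚ) ^ k)
          ((p : ℚ) / 2 * ((legendreSym 3 (p : ℤ) : ℚ) - 1)
            + (p : ℚ) ^ 2 / 2
              * (SunTM.fermatQuotient p 3 + (legendreSym 3 (p : ℤ) : ℚ) + 3))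
      ∧ SunTM.CongMod p 3
          (∑ k ∈ Finset.range p, (SunTM.T k 3 3 : ℚ) * (SunTM.M k 3 3 : ℚ) / (-3 : ℚ) ^ k)
          (3 * (p : ℚ) / 2 * ((legendreSym 3 (p : ℤ) : ℚ) - 1)
            + (p : ℚ) ^ 2 / 2 * (3 * (legendreSym 3 (p : ℤ) : ℚ) + 1))
      ∧ SunTM.CongMod p 1
          (∑ k ∈ Finset.range p,
            (k : ℚ) * (SunTM.T k 1 1 : ℚ) * (SunTM.M k 1 1 : ℚ) / (-3 : ℚ) ^ k)
          (2 * (legendreSym 3 (p : ℤ) : ℚ))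
      ∧ SunTM.CongMod p 1
          (∑ k ∈ Finset.range p,
            (k : ℚ) * (SunTM.T k 3 3 : ℚ) * (SunTM.M k 3 3 : ℚ) / (-3 : ℚ) ^ k)
          (2 * (legendreSym p (-1) : ℚ))) := by
  refine ⟨fun n hn => ⟨SunTM.average_one_one hn, SunTM.average_three_three hn⟩, fun p hp hp3 => ?_⟩
  exact ⟨SunTM.sum_one_one_congMod hp.out hp3, SunTM.sum_three_three_congMod hp.out hp3,
    SunTM.sum_mul_one_one_congMod hp3, SunTM.sum_mul_three_three_congMod hp3⟩
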